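/- Let $n\ge 2$, let $B$ be the open unit ball of $\mathbb R^n$ with boundary $S=\mathbb S^{n-1}$ and exterior normal $\nu$, and let $H^2_*(B)=\{u\in H^2(B):\partial_\nu u=0 \text{ on } S\}$ (real-valued functions, boundary values in the sense of traces). Consider the biharmonic Steklov problem $$\Delta^2u=0 \ \text{ in } B,\qquad \partial_\nu u=0 \ \text{ on } S,\qquad -\partial_\nu\Delta u=\mu u\ \text{ on } S,\qquad \mu=\lambda^4.$$ A real number $\mu$ is an eigenvalue, with eigenfunction $u\ne0$, if $u\in H^2_*(B)$ and $\int_B\Delta u\,\Delta v=\mu\int_S uv$ for all $v\in H^2_*(B)$. A spherical harmonic of order $\ell\in\{0,1,2,\dots\}$ is a smooth function $Y$ on $S$ with $-\Delta_{S}Y=\ell(\ell+n-2)Y$. Then: 1. A real number $\mu$ is an eigenvalue if and only if $\mu=\lambda^4=\ell^2(2\ell+n)$ for some $\ell\in\{0,1,2,\dots\}$. 2. For every $\ell$, the eigenfunctions with eigenvalue $\ell^2(2\ell+n)$ are exactly the functions which, in polar coordinates $x=r\theta$, agree almost everywhere in $B$ with $$u_\ell(r,\theta)=\big((\ell+2)r^\ell-\ell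 r^{\ell+2}\big)\,\mathcal Y_\ell(\theta),$$ where $\mathcal Y_\ell\not\equiv0$ is a spherical harmonic of order $\ell$. 3. For every $\ell$ and every spherical harmonic $\mathcal Y_\ell$ of order $\ell$, the function $u_\ell$ extends to a smooth function on $\mathbb R^n$ that satisfies the differential equation and both boundary conditions pointwise, with $\mu=\ell^2(2\ell+n)$. -/

import Mathlib

open MeasureTheory Metric Filter
open scoped Topology ContDiff ENNReal Laplacian

noncomputable section

namespace BiharmonicSteklov

/-- Euclidean space `ℝⁿ`. -/
abbrev Space (n : ℕ) : Type := EuclideanSpace ℝ (Fin n)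

/-- The unit sphere of `ℝⁿ`, the boundary of the unit ball. -/
abbrev Sphere (n : ℕ) : Type := sphere (0 : Space n) 1

/-- Lebesgue measure on the open unit ball. -/
def ballMeasure (n : ℕ) : Measure (Space n) :=
  (volume : Measure (Space n)).restrict (ball 0 1)

/-- Surface measure on the unit sphere. -/
def sphereMeasure (n : ℕ) : Measure (Sphere n) :=
  (volume : Measure (Space n)).toSphere

/-- The classical partial derivative `∂ᵢ f`. -/
def partialDeriv {n : ℕ} (i : Fin n) (f : Space n → ℝ) : Space n → ℝ :=
  fun x => fderiv ℝ f x (EuclideanSpace.single i 1)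

/-- The classical exterior normal derivative `∂_ν f` on the unit sphere; the exterior unit normal
of the unit ball at `θ` is `θ`. -/
def normalDeriv {n : ℕ} (f : Space n → ℝ) : Sphere n → ℝ :=
  fun θ => fderiv ℝ f (θ : Space n) (θ : Space n)

/-- `g` is the weak `i`-th partial derivative of `f` in the unit ball. -/
def IsWeakPartial {n : ℕ} (i : Fin n) (f g : Space n → ℝ) : Prop :=
  ∀ φ : Space n → ℝ, ContDiff ℝ ∞ φ → HasCompactSupport φ → tsupport φ ⊆ ball 0 1 →
    ∫ x, f x * partialDeriv i φ x ∂ballMeasure n = - ∫ x, g x * φ x ∂ballMeasure n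

/-- A function of `H²` of the unit ball, with its weak derivatives of orders one and two, which it
determines up to null sets. -/
structure H2 (n : ℕ) where
  /-- the function -/
  val : Space n → ℝ
  /-- the first weak derivatives -/
  grad : Fin n → Space n → ℝ
  /-- the second weak derivatives -/
  hess : Fin n → Fin n → Space n → ℝ
  memLp_val : MemLp val 2 (ballMeasure n)
  memLp_grad : ∀ i, MemLp (grad i) 2 (ballMeasure n)
  memLp_hess : ∀ i j, MemLp (hess i j) 2 (ballMeasure n)
  weak_grad : ∀ i, IsWeakPartial i val (grad i)
  weak_hess : ∀ i j, IsWeakPartial j (grad i) (hess i j)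

/-- The weak Laplacian of an `H²` function. -/
def H2.laplacian {n : ℕ} (U : H2 n) : Space n → ℝ := fun x => ∑ i, U.hess i i x

/-- The functions `φ k` converge to `U` in the norm of `H²` of the unit ball. -/
def TendstoH2 {n : ℕ} (φ : ℕ → Space n → ℝ) (U : H2 n) : Prop :=
  Tendsto (fun k => eLpNorm (fun x => φ k x - U.val x) 2 (ballMeasure n)) atTop (𝓝 0) ∧
  (∀ i, Tendsto (fun k => eLpNorm (fun x => partialDeriv i (φ k) x - U.grad i x) 2
    (ballMeasure n)) atTop (𝓝 0)) ∧
  (∀ i j, Tendsto (fun k => eLpNorm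
    (fun x => partialDeriv j (partialDeriv i (φ k)) x - U.hess i j x) 2
    (ballMeasure n)) atTop (𝓝 0))

/-- `(g₀, g₁)` is the pair of traces `(u, ∂_ν u)` on the unit sphere of the `H²` function `U`: the
trace map `H² → L² × L²` is the continuous extension of `φ ↦ (φ|, ∂_ν φ|)` from the functions that
are smooth up to the boundary. -/
def HasTraces {n : ℕ} (U : H2 n) (g₀ g₁ : Sphere n → ℝ) : Prop :=
  MemLp g₀ 2 (sphereMeasure n) ∧ MemLp g₁ 2 (sphereMeasure n) ∧
  ∃ φ : ℕ → Space n → ℝ, (∀ k, ContDiff ℝ ∞ (φ k)) ∧ TendstoH2 φ U ∧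
    Tendsto (fun k => eLpNorm (fun θ : Sphere n => φ k θ - g₀ θ) 2 (sphereMeasure n))
      atTop (𝓝 0) ∧
    Tendsto (fun k => eLpNorm (fun θ : Sphere n => normalDeriv (φ k) θ - g₁ θ) 2
      (sphereMeasure n)) atTop (𝓝 0)

/-- `U` is a weak solution of `Δ² u = 0` in the unit ball with `∂_ν u = 0`, `-∂_ν Δu = μ u` on the
unit sphere: `U` lies in `H²_* = {u ∈ H² : ∂_ν u = 0}` and
`∫ Δu Δv = μ ∫_{∂} u v` for all `v ∈ H²_*`. -/
def IsWeakSolution {n : ℕ} (μ : ℝ) (U : H2 n) : Prop :=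
  ∃ g : Sphere n → ℝ, HasTraces U g 0 ∧
    ∀ (V : H2 n) (h : Sphere n → ℝ), HasTraces V h 0 →
      ∫ x, U.laplacian x * V.laplacian x ∂ballMeasure n = μ * ∫ θ, g θ * h θ ∂sphereMeasure n

/-- `u` is an eigenfunction, with eigenvalue `μ`, of the biharmonic Steklov problem on the unit
ball. As an element of `H²`, `u` is a function up to null sets of the ball. -/
def IsEigenfunction (n : ℕ) (μ : ℝ) (u : Space n → ℝ) : Prop :=
  ¬ (u =ᵐ[ballMeasure n] 0) ∧ ∃ U : H2 n, U.val = u ∧ IsWeakSolution μ U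

/-- `μ` is an eigenvalue of the biharmonic Steklov problem on the unit ball of `ℝⁿ`. -/
def IsEigenvalue (n : ℕ) (μ : ℝ) : Prop := ∃ u, IsEigenfunction n μ u

/-- `w`, smooth up to the boundary, solves the boundary value problem pointwise. -/
def IsClassicalSolution {n : ℕ} (μ : ℝ) (w : Space n → ℝ) : Prop :=
  ContDiff ℝ ∞ w ∧
  (∀ x ∈ ball (0 : Space n) 1, Δ (Δ w) x = 0) ∧
  (∀ θ : Sphere n, normalDeriv w θ = 0) ∧
  (∀ θ : Sphere n, - normalDeriv (Δ w) θ = μ * w θ)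

/-- The extension `x ↦ Y (x / |x|)` of a function on the unit sphere, constant along rays (the value
at the origin is arbitrary). -/
def radialExt {n : ℕ} (Y : Sphere n → ℝ) (x : Space n) : ℝ :=
  if h : x = 0 then 0
  else Y ⟨‖x‖⁻¹ • x, by
    rw [mem_sphere_zero_iff_norm, norm_smul, norm_inv, norm_norm,
      inv_mul_cancel₀ (norm_ne_zero_iff.mpr h)]⟩

/-- The Laplace-Beltrami operator of the unit sphere: the restriction to the sphere of the Laplacian
of the extension that is constant along rays. -/
def laplaceBeltrami {n : ℕ} (Y : Sphere n → ℝ) : Sphere n → ℝ :=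
  fun θ => Δ (radialExt Y) (θ : Space n)

/-- `Y` is a spherical harmonic of order `ℓ` (or zero): it is smooth on the sphere and
`-Δ_S Y = ℓ (ℓ + n - 2) Y`. -/
def IsSphericalHarmonic {n : ℕ} (ℓ : ℕ) (Y : Sphere n → ℝ) : Prop :=
  ContDiffOn ℝ ∞ (radialExt Y) {0}ᶜ ∧
  ∀ θ, - laplaceBeltrami Y θ = (ℓ : ℝ) * ((ℓ : ℝ) + (n : ℝ) - 2) * Y θ

/-- The function `((ℓ + 2) r^ℓ - ℓ r^(ℓ+2)) Y(θ)` in polar coordinates `x = r θ`, for `x ≠ 0`. -/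
def mode {n : ℕ} (ℓ : ℕ) (Y : Sphere n → ℝ) (x : Space n) : ℝ :=
  (((ℓ : ℝ) + 2) * ‖x‖ ^ ℓ - (ℓ : ℝ) * ‖x‖ ^ (ℓ + 2)) * radialExt Y x

end BiharmonicSteklov

end

noncomputable section

namespace BiharmonicSteklov

variable {n : ℕ}

/-! Everything is read off from integrals against the polynomials `|x|^(2j) P`, with `P` homogeneous
harmonic of degree `ℓ`. These span all polynomials (`mem_harmonicSpan_of_isHomogeneous`), and
polynomial moments determine an integrable function on the ball (`ae_eq_zero_of_moments`).

Let `u` be a weak solution with Laplacian `f` and trace `g`. As `∂_ν u = 0`, Green's identity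
against `P` gives `∫ f P = -ℓ ∫ g P`. For `ℓ ≠ 0` the polynomial `|x|² P - ((ℓ+2)/ℓ) P` has zero
normal derivative, Laplacian `2(2ℓ+n) P` and boundary values `-(2/ℓ) P`, so the weak equation gives
`2(2ℓ+n) ∫ f P = -(2μ/ℓ) ∫ g P`. If `∫ g P ≠ 0`, then `μ = ℓ²(2ℓ+n)`; for `ℓ = 0`, testing with
constants gives `μ = 0` (`IsMomentSolution.eigenvalue_eq`). If `∫ g P = 0`, the same tests with
higher powers of `|x|²` kill first the moments of `f`, then those of `u`, along `P`
(`IsMomentSolution.moment_eq_zero`). Thus `u` is determined by the harmonic components of `g`, and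
subtracting a suitable mode from an eigenfunction leaves zero, since distinct orders have distinct
eigenvalues.

Conversely, a mode built from a harmonic polynomial is itself a polynomial solving the problem
classically, hence weakly by Green's identity. The link to Laplace-Beltrami eigenfunctions is
`IsSphericalHarmonic.exists_ev`: they are exactly restrictions of harmonic polynomials. -/

/-! ### Partial derivatives and the Laplacian in coordinates -/

lemma sum_smul_single (v : Space n) : v = ∑ i, v i • EuclideanSpace.single i (1 : ℝ) := by
  ext j
  simp [Finset.sum_apply, Pi.single_apply]

lemma fderiv_apply_eq_sum (f : Space n → ℝ) (x v : Space n) :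
    fderiv ℝ f x v = ∑ i, v i * partialDeriv i f x := by
  conv_lhs => rw [sum_smul_single v]
  simp [map_sum, partialDeriv]

lemma contDiff_partialDeriv {f : Space n → ℝ} (hf : ContDiff ℝ ∞ f) (i : Fin n) :
    ContDiff ℝ ∞ (partialDeriv i f) := by
  have h : ContDiff ℝ ∞ (fderiv ℝ f) := hf.fderiv_right (by simp)
  exact h.clm_apply contDiff_const

lemma continuous_partialDeriv {f : Space n → ℝ} (hf : ContDiff ℝ 1 f) (i : Fin n) :
    Continuous (partialDeriv i f) :=
  (hf.continuous_fderiv one_ne_zero).clm_apply continuous_const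

lemma laplacian_eq_sum {f : Space n → ℝ} {x : Space n} (hf : ContDiffAt ℝ 2 f x) :
    Δ f x = ∑ i, partialDeriv i (partialDeriv i f) x := by
  rw [InnerProductSpace.laplacian_eq_iteratedFDeriv_orthonormalBasis f
    (EuclideanSpace.basisFun (Fin n) ℝ)]
  refine Finset.sum_congr rfl fun i _ => ?_
  have h : DifferentiableAt ℝ (fderiv ℝ f) x :=
    (hf.fderiv_right (m := 1) (by norm_num)).differentiableAt (by norm_num)
  rw [iteratedFDeriv_two_apply]
  unfold partialDeriv
  rw [fderiv_clm_apply h (by fun_prop)]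
  simp

lemma laplacian_eq_sum' {f : Space n → ℝ} (hf : ContDiff ℝ ∞ f) :
    Δ f = fun x => ∑ i, partialDeriv i (partialDeriv i f) x :=
  funext fun _ => laplacian_eq_sum (hf.contDiffAt.of_le (by norm_cast))

lemma contDiff_laplacian {f : Space n → ℝ} (hf : ContDiff ℝ ∞ f) : ContDiff ℝ ∞ (Δ f) := by
  rw [laplacian_eq_sum' hf]
  exact ContDiff.sum fun i _ => contDiff_partialDeriv (contDiff_partialDeriv hf i) i

/-! ### Integration on the ball and the sphere in polar coordinates -/

instance : IsFiniteMeasure (sphereMeasure n) := by unfold sphereMeasure; infer_instance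
instance : (sphereMeasure n).IsOpenPosMeasure := by unfold sphereMeasure; infer_instance
instance : IsFiniteMeasure (ballMeasure n) := by
  unfold ballMeasure
  exact ⟨by simpa using measure_ball_lt_top⟩

/-- Integration in polar coordinates. -/
lemma integral_polar (hn : 1 ≤ n) {f : Space n → ℝ} (hf : Integrable f) :
    ∫ x, f x = ∫ r in Set.Ioi (0 : ℝ),
      r ^ (n - 1) * ∫ θ : Sphere n, f (r • (θ : Space n)) ∂sphereMeasure n := by
  have : Nonempty (Fin n) := ⟨⟨0, hn⟩⟩
  have hmp := (volume : Measure (Space n)).measurePreserving_homeomorphUnitSphereProd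
  have hemb := (Homeomorph.measurableEmbedding (homeomorphUnitSphereProd (Space n)))
  rw [finrank_euclideanSpace_fin] at hmp
  set F : Sphere n × Set.Ioi (0 : ℝ) → ℝ := fun p => f (p.2.1 • (p.1 : Space n)) with hF
  have hcomp : ∀ x : ({(0)}ᶜ : Set (Space n)), F (homeomorphUnitSphereProd (Space n) x) = f x := by
    intro x
    have hx : ‖(x : Space n)‖ ≠ 0 := norm_ne_zero_iff.2 x.2
    simp [hF, smul_smul, hx]
  have hint : Integrable F ((volume : Measure (Space n)).toSphere.prod
      (Measure.volumeIoiPow (n - 1))) := by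
    rw [← hmp.integrable_comp_emb hemb]
    have : F ∘ (homeomorphUnitSphereProd (Space n)) = fun x : ({(0)}ᶜ : Set (Space n)) => f (x : Space n) := funext hcomp
    rw [this]
    exact ((integrableOn_iff_comap_subtypeVal (measurableSet_singleton (0 : Space n)).compl).1
      hf.integrableOn)
  calc ∫ x, f x = ∫ x : ({(0)}ᶜ : Set (Space n)), f x ∂((volume : Measure (Space n)).comap (↑)) := by
        rw [integral_subtype_comap (measurableSet_singleton _).compl f, restrict_compl_singleton]
    _ = ∫ p, F p ∂((volume : Measure (Space n)).toSphere.prod (Measure.volumeIoiPow (n - 1))) := by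
        rw [← hmp.integral_comp hemb]
        simp_rw [hcomp]
    _ = ∫ r, ∫ θ, F (θ, r) ∂sphereMeasure n ∂(Measure.volumeIoiPow (n - 1)) :=
        integral_prod_symm _ hint
    _ = _ := by
      simp only [Measure.volumeIoiPow, ENNReal.ofReal]
      rw [integral_withDensity_eq_integral_smul
        ((measurable_subtype_coe.pow_const _).real_toNNReal)]
      rw [integral_subtype_comap measurableSet_Ioi fun a : ℝ =>
        Real.toNNReal (a ^ (n - 1)) • ∫ θ : Sphere n, f (a • (θ : Space n)) ∂sphereMeasure n]
      refine setIntegral_congr_fun measurableSet_Ioi fun r hr => ?_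
      simp only [NNReal.smul_def, smul_eq_mul]
      rw [Real.coe_toNNReal _ (pow_nonneg (le_of_lt hr) _)]

/-- The integral of `θ ↦ f (r θ)` over the unit sphere. -/
def sphereIntegral (f : Space n → ℝ) (r : ℝ) : ℝ :=
  ∫ θ : Sphere n, f (r • (θ : Space n)) ∂sphereMeasure n

lemma continuous_sphereIntegral {f : Space n → ℝ} (hf : Continuous f) :
    Continuous (sphereIntegral f) := by
  unfold sphereIntegral
  have h := continuous_parametric_integral_of_continuous (μ := sphereMeasure n)
    (f := fun (r : ℝ) (θ : Sphere n) => f (r • (θ : Space n))) (s := Set.univ) ?_ isCompact_univ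
  · simpa using h
  · simp only [Function.uncurry_def]
    fun_prop

lemma integrable_sphere {f : Sphere n → ℝ} (hf : Continuous f) :
    Integrable f (sphereMeasure n) :=
  hf.integrable_of_hasCompactSupport
    (IsCompact.of_isClosed_subset isCompact_univ (isClosed_tsupport f) (Set.subset_univ _))

lemma integrable_ball {f : Space n → ℝ} (hf : Continuous f) : Integrable f (ballMeasure n) :=
  (hf.continuousOn.integrableOn_compact (isCompact_closedBall 0 1)).mono_set
      ball_subset_closedBall

lemma integral_ball_polar (hn : 1 ≤ n) {f : Space n → ℝ} (hf : Continuous f) :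
    ∫ x, f x ∂ballMeasure n = ∫ r in (0 : ℝ)..1, r ^ (n - 1) * sphereIntegral f r := by
  have h1 : Integrable ((ball (0 : Space n) 1).indicator f) :=
    (integrable_indicator_iff measurableSet_ball).2 (integrable_ball hf)
  rw [ballMeasure, ← integral_indicator measurableSet_ball, integral_polar hn h1,
    intervalIntegral.integral_of_le zero_le_one, integral_Ioc_eq_integral_Ioo,
    ← Set.Ioi_inter_Iio, ← setIntegral_indicator measurableSet_Iio]
  refine setIntegral_congr_fun measurableSet_Ioi fun r (hr : 0 < r) => ?_
  by_cases h : r < 1 <;> simp [sphereIntegral, Set.indicator, norm_smul, abs_of_pos hr, h]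

/-! ### The divergence theorem on balls -/

/-- The flux of the vector field `F` through the sphere of radius `r`. -/
def flux (F : Fin n → Space n → ℝ) (r : ℝ) : ℝ :=
  r ^ (n - 1) * ∫ θ : Sphere n, ∑ i, (θ : Space n) i * F i (r • (θ : Space n)) ∂sphereMeasure n

lemma continuous_flux {F : Fin n → Space n → ℝ} (hF : ∀ i, Continuous (F i)) :
    Continuous (flux F) := by
  unfold flux
  refine Continuous.mul (by fun_prop) ?_
  have h := continuous_parametric_integral_of_continuous (μ := sphereMeasure n)
    (f := fun (r : ℝ) (θ : Sphere n) => ∑ i, (θ : Space n) i * F i (r • (θ : Space n)))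
    (s := Set.univ) ?_ isCompact_univ
  · simpa using h
  · simp only [Function.uncurry_def]
    fun_prop

/-- The divergence of a vector field. -/
def divergence (F : Fin n → Space n → ℝ) (x : Space n) : ℝ := ∑ i, partialDeriv i (F i) x

lemma continuous_divergence {F : Fin n → Space n → ℝ} (hF : ∀ i, ContDiff ℝ 1 (F i)) :
    Continuous (divergence F) :=
  continuous_finsetSum _ fun i _ => continuous_partialDeriv (hF i) i

lemma setIntegral_Ioi_eq_intervalIntegral {f : ℝ → ℝ} {M : ℝ} (hM : 0 ≤ M)
    (hf : ∀ r, M ≤ r → f r = 0) : ∫ r in Set.Ioi (0 : ℝ), f r = ∫ r in (0 : ℝ)..M, f r := by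
  rw [intervalIntegral.integral_of_le hM]
  refine setIntegral_eq_of_subset_of_forall_sdiff_eq_zero measurableSet_Ioi
    Set.Ioc_subset_Ioi_self fun r hr => hf r ?_
  by_contra h
  exact hr.2 ⟨hr.1, (not_le.1 h).le⟩

lemma partialDeriv_comp_norm {χ : ℝ → ℝ} {c : ℝ} {x : Space n} (hx : x ≠ 0)
    (hχ : HasDerivAt χ c ‖x‖) (i : Fin n) :
    DifferentiableAt ℝ (fun y : Space n => χ ‖y‖) x ∧
      partialDeriv i (fun y : Space n => χ ‖y‖) x = c * ‖x‖⁻¹ * x i := by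
  have h0 : ‖x‖ ^ 2 ≠ 0 := pow_ne_zero _ (norm_ne_zero_iff.2 hx)
  have h1 := (hasStrictFDerivAt_norm_sq x).hasFDerivAt.sqrt h0
  simp only [Real.sqrt_sq (norm_nonneg _)] at h1
  have h2 : HasFDerivAt (fun y : Space n => χ ‖y‖) _ x := hχ.comp_hasFDerivAt x h1
  refine ⟨h2.differentiableAt, ?_⟩
  unfold partialDeriv
  rw [h2.fderiv]
  simp [EuclideanSpace.inner_single_right]
  ring

/-- The divergence theorem on balls, tested against radial functions. -/
lemma integral_mul_flux_eq (hn : 1 ≤ n) {F : Fin n → Space n → ℝ} (hF : ∀ i, ContDiff ℝ 1 (F i))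
    {g : ℝ → ℝ} (hg : Continuous g) (hgs : HasCompactSupport g) (hgp : tsupport g ⊆ Set.Ioi 0) :
    ∫ r in Set.Ioi (0 : ℝ), g r * flux F r = ∫ r in Set.Ioi (0 : ℝ),
      g r * ∫ s in (0 : ℝ)..r, s ^ (n - 1) * sphereIntegral (divergence F) s := by
  have hD : Continuous fun s : ℝ => s ^ (n - 1) * sphereIntegral (divergence F) s :=
    (by fun_prop : Continuous fun s : ℝ => s ^ (n - 1)).mul
      (continuous_sphereIntegral (continuous_divergence hF))
  have hFc := fun i => (hF i).continuous
  have hg0 : ∀ᶠ r in 𝓝 (0 : ℝ), g r = 0 :=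
    notMem_tsupport_iff_eventuallyEq.1 fun h => by simpa using hgp h
  obtain ⟨ε, hε, hgε⟩ := Metric.eventually_nhds_iff.1 hg0
  obtain ⟨M, hM, hgM⟩ : ∃ M : ℝ, 0 < M ∧ ∀ r, M ≤ r → g r = 0 := by
    obtain ⟨M, hM⟩ := hgs.isCompact.isBounded.subset_closedBall (0 : ℝ)
    refine ⟨max M 0 + 1, by positivity, fun r hr => image_eq_zero_of_notMem_tsupport fun h => ?_⟩
    have := hM h
    rw [mem_closedBall_zero_iff, Real.norm_eq_abs] at this
    linarith [le_abs_self r, le_max_left M 0]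
  -- A primitive of `-g` that vanishes beyond `M` and is constant near `0`: the radial function `χ
  -- ‖x‖` then has compact support and is differentiable at the origin too.
  set χ : ℝ → ℝ := fun r => - ∫ s in M..r, g s with hχ
  have hχd : ∀ r, HasDerivAt χ (-g r) r := fun r =>
    (hg.integral_hasStrictDerivAt M r).hasDerivAt.neg
  have hχc : Continuous χ := continuous_iff_continuousAt.2 fun r => (hχd r).continuousAt
  have hχM : ∀ r, M ≤ r → χ r = 0 := fun r hr => by
    simp only [hχ, neg_eq_zero]
    refine (intervalIntegral.integral_congr fun s hs => ?_).trans intervalIntegral.integral_zero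
    rw [Set.uIcc_of_le hr] at hs
    exact hgM s hs.1
  have hχ0 : ∀ r, dist r 0 < ε → χ r = χ 0 := fun r hr => by
    have h1 := intervalIntegral.integral_add_adjacent_intervals
      (hg.intervalIntegrable (μ := volume) M 0) (hg.intervalIntegrable 0 r)
    have h2 : ∫ s in (0 : ℝ)..r, g s = 0 := by
      refine (intervalIntegral.integral_congr fun s hs => ?_).trans intervalIntegral.integral_zero
      refine hgε (lt_of_le_of_lt ?_ hr)
      rw [Real.dist_eq, Real.dist_eq]
      exact Set.abs_sub_left_of_mem_uIcc hs
    simp only [hχ, ← h1, h2, add_zero]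
  have hgi : Continuous fun r => g r * r⁻¹ := by
    refine continuous_iff_continuousAt.2 fun r => ?_
    rcases eq_or_ne r 0 with rfl | hr
    · exact (continuousAt_const (y := (0 : ℝ))).congr (hg0.mono fun r hr => by simp [hr])
    · exact hg.continuousAt.mul (continuousAt_inv₀ hr)
  set η : Space n → ℝ := fun x => χ ‖x‖ with hη
  have hηc : Continuous η := hχc.comp continuous_norm
  have hηs : HasCompactSupport η := by
    refine HasCompactSupport.intro (isCompact_closedBall (0 : Space n) M) fun x hx => hχM _ ?_
    rw [mem_closedBall_zero_iff, not_le] at hx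
    exact hx.le
  have hηd : ∀ (i : Fin n) (x : Space n), DifferentiableAt ℝ η x ∧
      partialDeriv i η x = - (g ‖x‖ * ‖x‖⁻¹ * x i) := by
    intro i x
    rcases eq_or_ne x 0 with rfl | hx
    · have : η =ᶠ[𝓝 0] fun _ => χ 0 := by
        filter_upwards [ball_mem_nhds (0 : Space n) hε] with y hy
        refine hχ0 _ ?_
        simpa using hy
      exact ⟨this.differentiableAt_iff.2 (differentiableAt_const _), by
        simp [partialDeriv, this.fderiv_eq]⟩
    · have := partialDeriv_comp_norm hx (hχd ‖x‖) i
      exact ⟨this.1, this.2.trans (by ring)⟩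
  have hηp : ∀ i, partialDeriv i η = fun x => - (g ‖x‖ * ‖x‖⁻¹ * x i) :=
    fun i => funext fun x => (hηd i x).2
  have hηpc : ∀ i, Continuous (partialDeriv i η) := fun i => by
    rw [hηp]
    exact ((hgi.comp continuous_norm).mul (by fun_prop)).neg
  have hηps : ∀ i, HasCompactSupport (partialDeriv i η) := fun i =>
    (hηs.fderiv_apply (𝕜 := ℝ) (EuclideanSpace.single i 1))
  have hdFc := fun i => continuous_partialDeriv (hF i) i
  -- Integration by parts on the whole space, without boundary terms; since `∇η = -g(|x|) x/|x|`,
  -- the right side becomes `∫ g · flux` in polar coordinates.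
  have ibp : ∀ i, ∫ x, η x * partialDeriv i (F i) x = - ∫ x, partialDeriv i η x * F i x := by
    intro i
    refine integral_mul_fderiv_eq_neg_fderiv_mul_of_integrable ?_ ?_ ?_
      (fun x _ => (hηd i x).1) (fun x _ => (hF i).differentiable (by simp) x)
    · exact ((hηpc i).mul (hFc i)).integrable_of_hasCompactSupport (hηps i).mul_right
    · exact (hηc.mul (hdFc i)).integrable_of_hasCompactSupport hηs.mul_right
    · exact (hηc.mul (hFc i)).integrable_of_hasCompactSupport hηs.mul_right
  have key : ∫ x, η x * divergence F x = ∫ x, -∑ i, partialDeriv i η x * F i x := by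
    simp only [divergence, Finset.mul_sum]
    rw [integral_neg, integral_finsetSum, integral_finsetSum, ← Finset.sum_neg_distrib]
    · exact Finset.sum_congr rfl fun i _ => ibp i
    · exact fun i _ => ((hηpc i).mul (hFc i)).integrable_of_hasCompactSupport (hηps i).mul_right
    · exact fun i _ => (hηc.mul (hdFc i)).integrable_of_hasCompactSupport hηs.mul_right
  rw [integral_polar hn, integral_polar hn] at key
  rotate_left
  · refine (Continuous.neg (continuous_finsetSum _ fun i _ =>
      (hηpc i).mul (hFc i))).integrable_of_hasCompactSupport ?_
    refine HasCompactSupport.intro (isCompact_closedBall (0 : Space n) M) fun x hx => ?_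
    rw [mem_closedBall_zero_iff, not_le] at hx
    simp [hηp, hgM _ hx.le]
  · exact (hηc.mul (continuous_divergence hF)).integrable_of_hasCompactSupport hηs.mul_right
  have hL : ∫ r in Set.Ioi (0 : ℝ), r ^ (n - 1) * ∫ θ : Sphere n,
        η (r • (θ : Space n)) * divergence F (r • (θ : Space n)) ∂sphereMeasure n =
      ∫ r in Set.Ioi (0 : ℝ), χ r * (r ^ (n - 1) * sphereIntegral (divergence F) r) := by
    refine setIntegral_congr_fun measurableSet_Ioi fun r (hr : 0 < r) => ?_
    simp only [hη, norm_smul, norm_eq_of_mem_sphere, mul_one, Real.norm_eq_abs, abs_of_pos hr,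
      integral_const_mul, sphereIntegral]
    ring
  have hR : ∫ r in Set.Ioi (0 : ℝ), r ^ (n - 1) * ∫ θ : Sphere n,
        -∑ i, partialDeriv i η (r • (θ : Space n)) * F i (r • (θ : Space n)) ∂sphereMeasure n =
      ∫ r in Set.Ioi (0 : ℝ), g r * flux F r := by
    refine setIntegral_congr_fun measurableSet_Ioi fun r (hr : 0 < r) => ?_
    simp only [flux]
    rw [mul_left_comm (g r), ← integral_const_mul (g r)]
    congr 2
    funext θ
    rw [Finset.mul_sum, ← Finset.sum_neg_distrib]
    refine Finset.sum_congr rfl fun i _ => ?_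
    simp only [hηp, norm_smul, norm_eq_of_mem_sphere, mul_one, Real.norm_eq_abs, abs_of_pos hr,
      PiLp.smul_apply, smul_eq_mul]
    field_simp
  -- One-dimensional integration by parts moves the derivative back from the primitive to `χ`; the
  -- boundary terms vanish because `χ M = 0` and the primitive is `0` at `0`.
  rw [← hR, ← key, hL, setIntegral_Ioi_eq_intervalIntegral hM.le
    (fun r hr => by rw [hχM r hr, zero_mul]), setIntegral_Ioi_eq_intervalIntegral hM.le
    (fun r hr => by rw [hgM r hr, zero_mul]), intervalIntegral.integral_mul_deriv_eq_deriv_mul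
    (v := fun r => ∫ s in (0 : ℝ)..r, s ^ (n - 1) * sphereIntegral (divergence F) s)
    (fun r _ => hχd r) (fun r _ => (hD.integral_hasStrictDerivAt 0 r).hasDerivAt)
    (hg.neg.intervalIntegrable _ _) (hD.intervalIntegrable _ _)]
  simp [hχM M le_rfl]

/-- By `integral_mul_flux_eq` the two continuous functions of `r` have the same integrals against
all test functions on `(0, ∞)`, so they agree almost everywhere, hence everywhere there. -/
lemma flux_eq (hn : 1 ≤ n) {F : Fin n → Space n → ℝ} (hF : ∀ i, ContDiff ℝ 1 (F i))
    {r : ℝ} (hr : 0 < r) :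
    flux F r = ∫ s in (0 : ℝ)..r, s ^ (n - 1) * sphereIntegral (divergence F) s := by
  set E : ℝ → ℝ := fun r => ∫ s in (0 : ℝ)..r, s ^ (n - 1) * sphereIntegral (divergence F) s
    with hE
  have hD : Continuous fun s : ℝ => s ^ (n - 1) * sphereIntegral (divergence F) s :=
    (by fun_prop : Continuous fun s : ℝ => s ^ (n - 1)).mul
      (continuous_sphereIntegral (continuous_divergence hF))
  have hEc : Continuous E := intervalIntegral.continuous_primitive (fun a b => hD.intervalIntegrable a b) 0
  have hAc : Continuous (flux F) := continuous_flux fun i => (hF i).continuous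
  have hsub : Continuous fun r => flux F r - E r := hAc.sub hEc
  have hae : ∀ᵐ r : ℝ, r ∈ Set.Ioi (0 : ℝ) → flux F r - E r = 0 := by
    refine isOpen_Ioi.ae_eq_zero_of_integral_contDiff_smul_eq_zero
      (hsub.locallyIntegrable.locallyIntegrableOn _) fun g hg hgs hgp => ?_
    have h := integral_mul_flux_eq hn hF hg.continuous hgs hgp
    have hi : ∀ f : ℝ → ℝ, Continuous f → Integrable (fun r => g r * f r) := fun f hf =>
      (hg.continuous.mul hf).integrable_of_hasCompactSupport (hgs.mul_right)
    have h0 : ∀ f : ℝ → ℝ, ∫ r in Set.Ioi (0 : ℝ), g r * f r = ∫ r, g r * f r := fun f =>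
      setIntegral_eq_integral_of_forall_compl_eq_zero fun r hr => by
        rw [image_eq_zero_of_notMem_tsupport fun h => hr (hgp h), zero_mul]
    rw [h0, h0] at h
    simp only [smul_eq_mul, mul_sub]
    rw [integral_sub (hi _ hAc) (hi _ hEc), h, sub_self]
  have hae' : (fun r => flux F r - E r) =ᵐ[volume.restrict (Set.Ioi (0 : ℝ))] fun _ => 0 :=
    (ae_restrict_iff' measurableSet_Ioi).2 hae
  have := Measure.eqOn_open_of_ae_eq hae' isOpen_Ioi hsub.continuousOn continuousOn_const hr
  exact sub_eq_zero.1 this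

/-- The Laplace-Beltrami equation gives the Laplacian of an extension on the unit sphere only, so
what it needs is this derivative at `r = 1`, not an integral over the ball. -/
lemma hasDerivAt_flux (hn : 1 ≤ n) {F : Fin n → Space n → ℝ} (hF : ∀ i, ContDiff ℝ 1 (F i))
    {r : ℝ} (hr : 0 < r) :
    HasDerivAt (flux F) (r ^ (n - 1) * sphereIntegral (divergence F) r) r := by
  have hD : Continuous fun s : ℝ => s ^ (n - 1) * sphereIntegral (divergence F) s :=
    (by fun_prop : Continuous fun s : ℝ => s ^ (n - 1)).mul
      (continuous_sphereIntegral (continuous_divergence hF))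
  refine (hD.integral_hasStrictDerivAt 0 r).hasDerivAt.congr_of_eventuallyEq ?_
  filter_upwards [lt_mem_nhds hr] with s hs using flux_eq hn hF hs

/-- The divergence theorem on the unit ball. -/
lemma integral_divergence (hn : 1 ≤ n) {F : Fin n → Space n → ℝ} (hF : ∀ i, ContDiff ℝ 1 (F i)) :
    ∫ x, divergence F x ∂ballMeasure n =
      ∫ θ : Sphere n, ∑ i, (θ : Space n) i * F i θ ∂sphereMeasure n := by
  rw [integral_ball_polar hn (continuous_divergence hF), ← flux_eq hn hF one_pos]
  simp [flux]

/-! ### Green's second identity for smooth functions -/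

lemma partialDeriv_mul {f g : Space n → ℝ} {x : Space n} (hf : DifferentiableAt ℝ f x)
    (hg : DifferentiableAt ℝ g x) (i : Fin n) :
    partialDeriv i (fun y => f y * g y) x = f x * partialDeriv i g x + partialDeriv i f x * g x := by
  unfold partialDeriv
  rw [fderiv_fun_mul hf hg]
  simp; ring

lemma partialDeriv_sub {f g : Space n → ℝ} {x : Space n} (hf : DifferentiableAt ℝ f x)
    (hg : DifferentiableAt ℝ g x) (i : Fin n) :
    partialDeriv i (fun y => f y - g y) x = partialDeriv i f x - partialDeriv i g x := by
  unfold partialDeriv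
  rw [fderiv_fun_sub hf hg]
  simp

/-- The vector field `f ∇ g - g ∇ f`. -/
def greenField (f g : Space n → ℝ) (i : Fin n) (x : Space n) : ℝ :=
  f x * partialDeriv i g x - g x * partialDeriv i f x

lemma contDiff_greenField {f g : Space n → ℝ} (hf : ContDiff ℝ ∞ f) (hg : ContDiff ℝ ∞ g)
    (i : Fin n) : ContDiff ℝ ∞ (greenField f g i) :=
  (hf.mul (contDiff_partialDeriv hg i)).sub (hg.mul (contDiff_partialDeriv hf i))

lemma differentiable_of_smooth {f : Space n → ℝ} (hf : ContDiff ℝ ∞ f) : Differentiable ℝ f :=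
  hf.differentiable (by simp)

lemma divergence_greenField {f g : Space n → ℝ} (hf : ContDiff ℝ ∞ f) (hg : ContDiff ℝ ∞ g) :
    divergence (greenField f g) = fun x => f x * Δ g x - g x * Δ f x := by
  funext x
  have hf' := fun i => differentiable_of_smooth (contDiff_partialDeriv hf i) x
  have hg' := fun i => differentiable_of_smooth (contDiff_partialDeriv hg i) x
  have hf0 := differentiable_of_smooth hf x
  have hg0 := differentiable_of_smooth hg x
  rw [laplacian_eq_sum' hf, laplacian_eq_sum' hg]
  simp only [Finset.mul_sum, ← Finset.sum_sub_distrib, divergence]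
  refine Finset.sum_congr rfl fun i _ => ?_
  unfold greenField
  rw [partialDeriv_sub (hf0.fun_mul (hg' i)) (hg0.fun_mul (hf' i)), partialDeriv_mul hf0 (hg' i),
    partialDeriv_mul hg0 (hf' i)]
  ring

lemma sum_mul_greenField (f g : Space n → ℝ) (x v : Space n) :
    ∑ i, v i * greenField f g i x = f x * fderiv ℝ g x v - g x * fderiv ℝ f x v := by
  simp only [fderiv_apply_eq_sum, Finset.mul_sum, ← Finset.sum_sub_distrib, greenField]
  exact Finset.sum_congr rfl fun i _ => by ring

lemma continuous_normalDeriv {f : Space n → ℝ} (hf : ContDiff ℝ ∞ f) :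
    Continuous (normalDeriv f) := by
  unfold normalDeriv
  exact ((hf.continuous_fderiv (by simp)).comp continuous_subtype_val).clm_apply
    continuous_subtype_val

/-- Green's second identity on the unit ball. -/
lemma green (hn : 1 ≤ n) {f g : Space n → ℝ} (hf : ContDiff ℝ ∞ f) (hg : ContDiff ℝ ∞ g) :
    ∫ x, Δ f x * g x ∂ballMeasure n = ∫ x, f x * Δ g x ∂ballMeasure n
      - ∫ θ : Sphere n, f θ * normalDeriv g θ ∂sphereMeasure n
      + ∫ θ : Sphere n, normalDeriv f θ * g θ ∂sphereMeasure n := by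
  have h := integral_divergence hn (F := greenField f g)
    fun i => (contDiff_greenField hf hg i).of_le (by norm_cast)
  simp only [divergence_greenField hf hg, sum_mul_greenField] at h
  have c1 := (contDiff_laplacian hf).continuous
  have c2 := (contDiff_laplacian hg).continuous
  have c3 := hf.continuous
  have c4 := hg.continuous
  have c5 := continuous_normalDeriv hf
  have c6 := continuous_normalDeriv hg
  rw [integral_sub (integrable_ball (by fun_prop)) (integrable_ball (by fun_prop))] at h
  change _ = ∫ θ : Sphere n, f θ * normalDeriv g θ - g θ * normalDeriv f θ ∂sphereMeasure n at h
  rw [integral_sub (integrable_sphere (by fun_prop)) (integrable_sphere (by fun_prop))] at h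
  simp only [mul_comm (Δ f _), mul_comm (normalDeriv f _)]
  linarith

/-! ### Decomposition of polynomials into harmonic ones times powers of `|x|²` -/

open MvPolynomial in
/-- The Laplacian of a polynomial. -/
def polyLaplacian : MvPolynomial (Fin n) ℝ →ₗ[ℝ] MvPolynomial (Fin n) ℝ :=
  ∑ i, (pderiv i).toLinearMap ∘ₗ (pderiv i).toLinearMap

open MvPolynomial in
/-- The polynomial `|x|²`. -/
def normSq (n : ℕ) : MvPolynomial (Fin n) ℝ := ∑ i, X i ^ 2

/-- The function on `ℝⁿ` defined by a polynomial. -/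
def ev (p : MvPolynomial (Fin n) ℝ) (x : Space n) : ℝ := MvPolynomial.eval (fun i => x i) p

section Algebra

open MvPolynomial

variable {d ℓ : ℕ} {p q : MvPolynomial (Fin n) ℝ}

lemma polyLaplacian_apply (p : MvPolynomial (Fin n) ℝ) :
    polyLaplacian p = ∑ i, pderiv i (pderiv i p) := by
  simp [polyLaplacian]

lemma isHomogeneous_normSq : (normSq n).IsHomogeneous 2 :=
  IsHomogeneous.sum _ _ _ fun i _ => isHomogeneous_X_pow i 2

lemma isHomogeneous_normSq_pow_mul (hp : p.IsHomogeneous ℓ) (j : ℕ) :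
    (normSq n ^ j * p).IsHomogeneous (2 * j + ℓ) :=
  (isHomogeneous_normSq.pow j).mul hp

lemma isHomogeneous_polyLaplacian (hp : p.IsHomogeneous (d + 2)) :
    (polyLaplacian p).IsHomogeneous d := by
  rw [polyLaplacian_apply]
  exact IsHomogeneous.sum _ _ _ fun i _ => hp.pderiv.pderiv

lemma pderiv_normSq (i : Fin n) : pderiv i (normSq n) = 2 * X i := by
  simp [normSq, Derivation.leibniz_pow, pderiv_X, Pi.single_apply]

/-- The Leibniz rule leaves the cross term `4 ∑ xᵢ ∂ᵢ p`, which is `4 d p` by Euler's identity. -/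
lemma polyLaplacian_normSq_mul (hp : p.IsHomogeneous d) :
    polyLaplacian (normSq n * p) = (2 * n + 4 * d : ℝ) • p + normSq n * polyLaplacian p := by
  have he := hp.sum_X_mul_pderiv
  have h : ∀ i : Fin n, pderiv i (pderiv i (normSq n * p)) =
      2 * p + 4 * (X i * pderiv i p) + normSq n * pderiv i (pderiv i p) := by
    intro i
    have h2 : pderiv i (2 : MvPolynomial (Fin n) ℝ) = 0 := by
      rw [← map_ofNat (C : ℝ →+* MvPolynomial (Fin n) ℝ) 2, pderiv_C]
    simp only [pderiv_mul, map_add, pderiv_normSq, pderiv_X_self, h2]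
    ring
  simp only [polyLaplacian_apply, h, Finset.sum_add_distrib, ← Finset.mul_sum, he]
  have h2 : (C 2 : MvPolynomial (Fin n) ℝ) = 2 := map_ofNat C 2
  have h4 : (C 4 : MvPolynomial (Fin n) ℝ) = 4 := map_ofNat C 4
  simp only [Finset.sum_const, Finset.card_univ, Fintype.card_fin, nsmul_eq_mul, smul_eq_C_mul,
    map_add, map_mul, map_natCast, h2, h4]
  ring

/-- The homogeneous harmonic polynomials of degree `ℓ`. -/
def harmonic (n ℓ : ℕ) : Submodule ℝ (MvPolynomial (Fin n) ℝ) :=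
  homogeneousSubmodule (Fin n) ℝ ℓ ⊓ LinearMap.ker polyLaplacian

lemma isHomogeneous_of_mem_harmonic (hp : p ∈ harmonic n ℓ) : p.IsHomogeneous ℓ := hp.1

lemma polyLaplacian_of_mem_harmonic (hp : p ∈ harmonic n ℓ) : polyLaplacian p = 0 := hp.2

instance (n ℓ : ℕ) : FiniteDimensional ℝ (harmonic n ℓ) := by
  have : Module.Finite ℝ (homogeneousSubmodule (Fin n) ℝ ℓ) :=
    Module.Finite.iff_fg.2 (homogeneousSubmodule_fg _ _ ℓ)
  exact Submodule.finiteDimensional_of_le inf_le_left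

/-- The constant is the sum of `2n + 4(2i + ℓ)` over `i ≤ j`. It is nonzero for `n ≥ 1`, which makes
the moment identities below solvable. -/
lemma polyLaplacian_normSq_pow_mul (hp : p ∈ harmonic n ℓ) (j : ℕ) :
    polyLaplacian (normSq n ^ (j + 1) * p) =
      (2 * (j + 1) * (2 * j + 2 * ℓ + n) : ℝ) • (normSq n ^ j * p) := by
  have hh := fun j => isHomogeneous_normSq_pow_mul (isHomogeneous_of_mem_harmonic hp) j
  induction j with
  | zero =>
    have := polyLaplacian_normSq_mul (isHomogeneous_of_mem_harmonic hp)
    rw [polyLaplacian_of_mem_harmonic hp, mul_zero, add_zero] at this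
    simp only [zero_add, pow_one, pow_zero, one_mul, this]
    congr 1
    push_cast
    ring
  | succ j ih =>
    rw [pow_succ', mul_assoc, polyLaplacian_normSq_mul (hh (j + 1)), ih, mul_smul_comm, ← mul_assoc,
      ← pow_succ', ← add_smul]
    congr 1
    push_cast
    ring

/-- The span of the polynomials `|x|^(2j) P` of degree `d` with `P` homogeneous and harmonic. -/
def harmonicSpan (n d : ℕ) : Submodule ℝ (MvPolynomial (Fin n) ℝ) :=
  Submodule.span ℝ {q | ∃ j ℓ, ∃ p ∈ harmonic n ℓ, 2 * j + ℓ = d ∧ q = normSq n ^ j * p}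

lemma normSq_mul_mem_harmonicSpan (hq : q ∈ harmonicSpan n d) :
    normSq n * q ∈ harmonicSpan n (d + 2) := by
  induction hq using Submodule.span_induction with
  | mem q hq =>
    obtain ⟨j, ℓ, p, hp, hd, rfl⟩ := hq
    exact Submodule.subset_span ⟨j + 1, ℓ, p, hp, by omega, by ring⟩
  | zero => simp
  | add a b _ _ ha hb => rw [mul_add]; exact add_mem ha hb
  | smul c a _ ha => rw [mul_smul_comm]; exact Submodule.smul_mem _ _ ha

/-- The map `r ↦ Δ(|x|² r)` multiplies each generator of the span by a nonzero constant, so it is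
onto. -/
lemma exists_polyLaplacian_normSq_mul_eq (hn : 1 ≤ n) (hq : q ∈ harmonicSpan n d) :
    ∃ r ∈ harmonicSpan n d, polyLaplacian (normSq n * r) = q := by
  induction hq using Submodule.span_induction with
  | mem q hq =>
    obtain ⟨j, ℓ, p, hp, hd, rfl⟩ := hq
    have hc : (2 * (j + 1) * (2 * j + 2 * ℓ + n) : ℝ) ≠ 0 := by positivity
    refine ⟨(2 * (j + 1) * (2 * j + 2 * ℓ + n) : ℝ)⁻¹ • (normSq n ^ j * p),
      Submodule.smul_mem _ _ (Submodule.subset_span ⟨j, ℓ, p, hp, hd, rfl⟩), ?_⟩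
    rw [mul_smul_comm, map_smul, ← mul_assoc, ← pow_succ', polyLaplacian_normSq_pow_mul hp,
      smul_smul, inv_mul_cancel₀ hc, one_smul]
  | zero => exact ⟨0, zero_mem _, by simp⟩
  | add a b _ _ ha hb =>
    obtain ⟨r, hr, rfl⟩ := ha
    obtain ⟨s, hs, rfl⟩ := hb
    exact ⟨r + s, add_mem hr hs, by rw [mul_add, map_add]⟩
  | smul c a _ ha =>
    obtain ⟨r, hr, rfl⟩ := ha
    exact ⟨c • r, Submodule.smul_mem _ _ hr, by rw [mul_smul_comm, map_smul]⟩

lemma pderiv_of_isHomogeneous_zero (hp : p.IsHomogeneous 0) (i : Fin n) : pderiv i p = 0 := by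
  rw [totalDegree_eq_zero_iff_eq_C.1 ((totalDegree_zero_iff_isHomogeneous _).2 hp), pderiv_C]

lemma mem_harmonic_of_isHomogeneous_of_lt (hd : d < 2) (hp : p.IsHomogeneous d) :
    p ∈ harmonic n d := by
  refine ⟨hp, ?_⟩
  rw [SetLike.mem_coe, LinearMap.mem_ker, polyLaplacian_apply]
  refine Finset.sum_eq_zero fun i _ => pderiv_of_isHomogeneous_zero ?_ i
  have := hp.pderiv (i := i)
  rwa [show d - 1 = 0 by omega] at this

/-- Induction on the degree in steps of two: write `Δp = Δ(|x|² r)` with `r` in the span of degree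
`d - 2`; then `p - |x|² r` is harmonic. -/
lemma mem_harmonicSpan_of_isHomogeneous (hn : 1 ≤ n) (hp : p.IsHomogeneous d) :
    p ∈ harmonicSpan n d := by
  have hsub : ∀ {d : ℕ} {q}, q ∈ harmonic n d → q ∈ harmonicSpan n d := fun {d q} hq =>
    Submodule.subset_span ⟨0, d, q, hq, by simp, by simp⟩
  have hhom : ∀ {d : ℕ} {q}, q ∈ harmonicSpan n d → q.IsHomogeneous d := by
    intro d q hq
    induction hq using Submodule.span_induction with
    | mem q hq =>
      obtain ⟨j, ℓ, p, hp, hd, rfl⟩ := hq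
      exact hd ▸ isHomogeneous_normSq_pow_mul (isHomogeneous_of_mem_harmonic hp) j
    | zero => exact isHomogeneous_zero _ _ _
    | add a b _ _ ha hb => exact ha.add hb
    | smul c a _ ha => exact (homogeneousSubmodule (Fin n) ℝ d).smul_mem c ha
  induction d using Nat.strong_induction_on generalizing p with
  | _ d ih =>
    rcases lt_or_ge d 2 with hd | hd
    · exact hsub (mem_harmonic_of_isHomogeneous_of_lt hd hp)
    · obtain ⟨d, rfl⟩ := Nat.exists_eq_add_of_le' hd
      obtain ⟨r, hr, hrp⟩ :=
        exists_polyLaplacian_normSq_mul_eq hn (ih d (by omega) (isHomogeneous_polyLaplacian hp))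
      have h1 : p - normSq n * r ∈ harmonic n (d + 2) := by
        refine ⟨hp.sub (by simpa [add_comm] using isHomogeneous_normSq.mul (hhom hr)), ?_⟩
        rw [SetLike.mem_coe, LinearMap.mem_ker, map_sub, hrp, sub_self]
      rw [← sub_add_cancel p (normSq n * r)]
      exact add_mem (hsub h1) (normSq_mul_mem_harmonicSpan hr)

/-- A linear functional which vanishes on the polynomials `|x|^(2j) P`, with `P` homogeneous and
harmonic, is zero. -/
lemma linearMap_ext_harmonic (hn : 1 ≤ n) {L : MvPolynomial (Fin n) ℝ →ₗ[ℝ] ℝ}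
    (h : ∀ j ℓ, ∀ p ∈ harmonic n ℓ, L (normSq n ^ j * p) = 0) : L = 0 := by
  refine LinearMap.ext fun p => ?_
  suffices L (∑ i ∈ Finset.range (p.totalDegree + 1), homogeneousComponent i p) = 0 by
    rwa [sum_homogeneousComponent] at this
  rw [map_sum]
  refine Finset.sum_eq_zero fun d _ => ?_
  have : harmonicSpan n d ≤ LinearMap.ker L := by
    refine Submodule.span_le.2 ?_
    rintro _ ⟨j, ℓ, p, hp, -, rfl⟩
    exact h j ℓ p hp
  exact this (mem_harmonicSpan_of_isHomogeneous hn (homogeneousComponent_isHomogeneous d p))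

end Algebra

/-! ### Polynomials as functions on space and on the sphere -/

section Evaluation

open MvPolynomial

variable {d ℓ : ℕ} {p q : MvPolynomial (Fin n) ℝ}

@[simp] lemma ev_add (p q : MvPolynomial (Fin n) ℝ) : ev (p + q) = fun x => ev p x + ev q x := by
  ext; simp [ev]
@[simp] lemma ev_sub (p q : MvPolynomial (Fin n) ℝ) : ev (p - q) = fun x => ev p x - ev q x := by
  ext; simp [ev]
@[simp] lemma ev_smul (c : ℝ) (p : MvPolynomial (Fin n) ℝ) : ev (c • p) = fun x => c * ev p x := by
  ext; simp [ev]
@[simp] lemma ev_mul (p q : MvPolynomial (Fin n) ℝ) : ev (p * q) = fun x => ev p x * ev q x := by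
  ext; simp [ev]
@[simp] lemma ev_zero : ev (0 : MvPolynomial (Fin n) ℝ) = 0 := by
  ext; simp [ev]

lemma ev_normSq (x : Space n) : ev (normSq n) x = ‖x‖ ^ 2 := by
  simp [ev, normSq, EuclideanSpace.real_norm_sq_eq]

lemma ev_normSq_pow_mul (j : ℕ) (p : MvPolynomial (Fin n) ℝ) (x : Space n) :
    ev (normSq n ^ j * p) x = ‖x‖ ^ (2 * j) * ev p x := by
  rw [ev_mul, pow_mul, ← ev_normSq]
  simp [ev]

lemma contDiff_ev (p : MvPolynomial (Fin n) ℝ) : ContDiff ℝ ∞ (ev p) := by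
  induction p using MvPolynomial.induction_on with
  | C a => unfold ev; simpa only [eval_C] using (contDiff_const : ContDiff ℝ ∞ fun _ : Space n => a)
  | add p q hp hq => rw [ev_add]; exact hp.add hq
  | mul_X p i hp =>
    rw [ev_mul]
    refine hp.mul ?_
    unfold ev
    simp only [eval_X]
    fun_prop

lemma continuous_ev (p : MvPolynomial (Fin n) ℝ) : Continuous (ev p) := (contDiff_ev p).continuous

lemma partialDeriv_ev (i : Fin n) (p : MvPolynomial (Fin n) ℝ) :
    partialDeriv i (ev p) = ev (pderiv i p) := by
  have hX : ∀ j, ev (X j : MvPolynomial (Fin n) ℝ) = fun x => x j := fun j => by ext; simp [ev]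
  induction p using MvPolynomial.induction_on with
  | C a =>
    have : ev (C a : MvPolynomial (Fin n) ℝ) = fun _ => a := by ext; simp [ev]
    ext x
    simp [partialDeriv, this]
  | add p q hp hq =>
    ext x
    simp only [map_add, ev_add, ← hp, ← hq]
    simp only [partialDeriv]
    rw [fderiv_fun_add (differentiable_of_smooth (contDiff_ev p) x)
      (differentiable_of_smooth (contDiff_ev q) x)]
    rfl
  | mul_X p j hp =>
    ext x
    have hd : DifferentiableAt ℝ (fun x : Space n => x j) x := by fun_prop
    have hx : partialDeriv i (fun x : Space n => x j) x = Pi.single (M := fun _ => ℝ) i 1 j := by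
      have h : HasFDerivAt (fun x : Space n => x j)
        (EuclideanSpace.proj j : Space n →L[ℝ] ℝ) x :=
        (EuclideanSpace.proj j : Space n →L[ℝ] ℝ).hasFDerivAt
      simp [partialDeriv, h.fderiv, Pi.single_apply]
    rw [pderiv_mul, ev_add, ev_mul, ev_mul, ev_mul, hX, partialDeriv_mul
      (differentiable_of_smooth (contDiff_ev p) x) hd, hp, hx, pderiv_X]
    rcases eq_or_ne i j with rfl | hij
    · simp [ev]; ring
    · simp [ev, Ne.symm hij]

lemma laplacian_ev (p : MvPolynomial (Fin n) ℝ) : Δ (ev p) = ev (polyLaplacian p) := by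
  rw [laplacian_eq_sum' (contDiff_ev p), polyLaplacian_apply]
  ext x
  simp [partialDeriv_ev]
  simp [ev]

lemma fderiv_ev_self (hp : p.IsHomogeneous d) (x : Space n) :
    fderiv ℝ (ev p) x x = d * ev p x := by
  rw [fderiv_apply_eq_sum]
  have := congrArg (fun q => ev q x) hp.sum_X_mul_pderiv
  simpa [partialDeriv_ev, ev] using this

lemma normalDeriv_ev (hp : p.IsHomogeneous d) (θ : Sphere n) :
    normalDeriv (ev p) θ = d * ev p θ := fderiv_ev_self hp _

lemma ev_smul_arg (hp : p.IsHomogeneous d) (r : ℝ) (x : Space n) :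
    ev p (r • x) = r ^ d * ev p x := by
  simp only [ev, eval_eq', Finset.mul_sum, PiLp.smul_apply, smul_eq_mul, mul_pow,
    Finset.prod_mul_distrib, Finset.prod_pow_eq_pow_sum]
  refine Finset.sum_congr rfl fun m hm => ?_
  have : ∑ i, m i = d := by
    rw [hp.degree_eq_sum_deg_support hm]
    exact (Finset.sum_subset (Finset.subset_univ _) (by simp)).symm
  rw [this]
  ring

lemma exists_eq_norm_smul (hn : 1 ≤ n) (x : Space n) :
    ∃ θ : Sphere n, x = ‖x‖ • (θ : Space n) := by
  rcases eq_or_ne x 0 with rfl | hx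
  · exact ⟨⟨EuclideanSpace.single ⟨0, hn⟩ 1, by simp⟩, by simp⟩
  · have hx' := norm_ne_zero_iff.2 hx
    exact ⟨⟨‖x‖⁻¹ • x, by simp [norm_smul, hx']⟩, by simp [smul_smul, hx']⟩

lemma eq_zero_of_ev_sphere_eq_zero (hn : 1 ≤ n) (hp : p.IsHomogeneous d)
    (h : ∀ θ : Sphere n, ev p θ = 0) : p = 0 := by
  refine MvPolynomial.funext fun x => ?_
  obtain ⟨θ, hθ⟩ := exists_eq_norm_smul hn (WithLp.toLp 2 x : Space n)
  have : ev p (WithLp.toLp 2 x) = 0 := by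
    rw [hθ, ev_smul_arg hp, h, mul_zero]
  simpa [ev] using this

/-- The real part of `(x₀ + i x₁)^ℓ` is a nonzero homogeneous harmonic polynomial. -/
lemma exists_mem_harmonic_ne_zero (hn : 2 ≤ n) (ℓ : ℕ) : ∃ p ∈ harmonic n ℓ, p ≠ 0 := by
  obtain ⟨u, v, huv⟩ : ∃ u v : Fin n, u ≠ v := ⟨⟨0, by omega⟩, ⟨1, by omega⟩, by simp⟩
  -- Real and imaginary parts are carried together: the Cauchy-Riemann equations make `a` harmonic,
  -- and the values at the basis vector `e_u` keep it nonzero.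
  suffices ∃ a b : MvPolynomial (Fin n) ℝ, a.IsHomogeneous ℓ ∧ b.IsHomogeneous ℓ ∧
      pderiv u a = pderiv v b ∧ pderiv v a = - pderiv u b ∧
      (∀ i, i ≠ u → i ≠ v → pderiv i a = 0 ∧ pderiv i b = 0) ∧
      eval (Pi.single u 1) a = 1 ∧ eval (Pi.single u 1) b = 0 by
    obtain ⟨a, b, ha, hb, h1, h2, h3, h4, -⟩ := this
    refine ⟨a, ⟨ha, ?_⟩, fun h => by simp [h] at h4⟩
    rw [SetLike.mem_coe, LinearMap.mem_ker, polyLaplacian_apply, ← Finset.sum_subset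
      (Finset.subset_univ {u, v}), Finset.sum_pair huv, h1, h2, map_neg]
    · have : pderiv u (pderiv v b) = pderiv v (pderiv u b) := by
        -- Partial derivatives commute because their commutator is a derivation that kills the
        -- variables.
        have h : ⁅pderiv (R := ℝ) (σ := Fin n) u, pderiv (R := ℝ) v⁆ = 0 := by
          refine derivation_ext fun i => ?_
          rw [Derivation.commutator_apply, pderiv_X, pderiv_X, Pi.single_apply, Pi.single_apply]
          split_ifs <;> simp
        have := congrArg (fun D => D b) h
        rwa [Derivation.commutator_apply, Derivation.zero_apply, sub_eq_zero] at this
      rw [this, add_neg_cancel]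
    · intro i _ hi
      simp only [Finset.mem_insert, Finset.mem_singleton, not_or] at hi
      rw [(h3 i hi.1 hi.2).1, map_zero]
  induction ℓ with
  | zero =>
    exact ⟨1, 0, isHomogeneous_one _ _, isHomogeneous_zero _ _ _, by simp, by simp, by simp,
      by simp, by simp⟩
  | succ ℓ ih =>
    obtain ⟨a, b, ha, hb, h1, h2, h3, h4, h5⟩ := ih
    have hX := fun i : Fin n => isHomogeneous_X ℝ i
    -- Multiplication of `a + i b` by `x_u + i x_v`.
    refine ⟨a * X u - b * X v, a * X v + b * X u, (ha.mul (hX u)).sub (hb.mul (hX v)),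
      (ha.mul (hX v)).add (hb.mul (hX u)), ?_, ?_, fun i hu hv => ⟨?_, ?_⟩, ?_, ?_⟩
    · simp [pderiv_X, huv, huv.symm, h1, h2]
      ring
    · simp [pderiv_X, huv, huv.symm, h1, h2]
      ring
    · simp [pderiv_X, hu.symm, hv.symm, h3 i hu hv]
    · simp [pderiv_X, hu.symm, hv.symm, h3 i hu hv]
    · simp [h4, h5]
    · simp [h4, h5, huv.symm]

/-- Every integrable function on the sphere has the same integrals against homogeneous harmonic
polynomials of degree `ℓ` as one of these polynomials. -/
lemma exists_harmonic_projection (hn : 1 ≤ n) (ℓ : ℕ) {f : Sphere n → ℝ}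
    (hf : Integrable f (sphereMeasure n)) :
    ∃ q ∈ harmonic n ℓ, ∀ p ∈ harmonic n ℓ,
      ∫ θ, f θ * ev p θ ∂sphereMeasure n = ∫ θ : Sphere n, ev q θ * ev p θ ∂sphereMeasure n := by
  have hc : ∀ p : MvPolynomial (Fin n) ℝ, Continuous fun θ : Sphere n => ev p θ := fun p =>
    (continuous_ev p).comp continuous_subtype_val
  have hb : ∀ p : MvPolynomial (Fin n) ℝ, ∃ C, ∀ θ : Sphere n, ‖ev p θ‖ ≤ C := fun p => by
    obtain ⟨C, hC⟩ := (isCompact_sphere (0 : Space n) 1).exists_bound_of_continuousOn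
      (continuous_ev p).continuousOn
    exact ⟨C, fun θ => hC θ θ.2⟩
  have hint : ∀ {g : Sphere n → ℝ}, Integrable g (sphereMeasure n) →
      ∀ p : MvPolynomial (Fin n) ℝ, Integrable (fun θ => g θ * ev p θ) (sphereMeasure n) := by
    intro g hg p
    obtain ⟨C, hC⟩ := hb p
    exact hg.mul_bdd (c := C) (hc p).aestronglyMeasurable (ae_of_all _ hC)
  let Λ (g : Sphere n → ℝ) (hg : Integrable g (sphereMeasure n)) :
      Module.Dual ℝ (harmonic n ℓ) :=
    { toFun := fun p => ∫ θ, g θ * ev (p : MvPolynomial (Fin n) ℝ) θ ∂sphereMeasure n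
      map_add' := fun p q => by
        simp only [Submodule.coe_add, ev_add, mul_add]
        exact integral_add (hint hg _) (hint hg _)
      map_smul' := fun c p => by
        simp only [Submodule.coe_smul, ev_smul, RingHom.id_apply, smul_eq_mul, mul_left_comm _ c]
        exact integral_const_mul _ _ }
  let B : harmonic n ℓ →ₗ[ℝ] Module.Dual ℝ (harmonic n ℓ) :=
    { toFun := fun q => Λ (fun θ => ev (q : MvPolynomial (Fin n) ℝ) θ) (integrable_sphere (hc _))
      map_add' := fun p q => by
        ext r
        simp only [Λ, LinearMap.coe_mk, AddHom.coe_mk, Submodule.coe_add, ev_add, add_mul,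
          LinearMap.add_apply]
        exact integral_add (hint (integrable_sphere (hc _)) _) (hint (integrable_sphere (hc _)) _)
      map_smul' := fun c p => by
        ext r
        simp only [Λ, LinearMap.coe_mk, AddHom.coe_mk, Submodule.coe_smul, ev_smul,
          RingHom.id_apply, mul_assoc, LinearMap.smul_apply, smul_eq_mul]
        exact integral_const_mul _ _ }
  -- The `L²` form is definite here: `∫ q² = 0` forces `q = 0` on the sphere, hence `q = 0` by
  -- homogeneity. In finite dimension an injective map to the dual is onto, which yields the
  -- projection.
  have hB : Function.Injective B := by
    rw [injective_iff_map_eq_zero]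
    intro q hq
    have h0 : ∫ θ : Sphere n, ev (q : MvPolynomial (Fin n) ℝ) θ *
        ev (q : MvPolynomial (Fin n) ℝ) θ ∂sphereMeasure n = 0 := LinearMap.congr_fun hq q
    have hcq := hc (q : MvPolynomial (Fin n) ℝ)
    rw [integral_eq_zero_iff_of_nonneg (fun θ => mul_self_nonneg _)
      (integrable_sphere (hcq.mul hcq))] at h0
    replace h0 := (Continuous.ae_eq_iff_eq _ (hcq.fun_mul hcq) continuous_zero).1 h0
    refine Subtype.ext (eq_zero_of_ev_sphere_eq_zero hn (isHomogeneous_of_mem_harmonic q.2)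
      fun θ => mul_self_eq_zero.1 (congrFun h0 θ))
  obtain ⟨q, hq⟩ := (LinearMap.injective_iff_surjective_of_finrank_eq_finrank
    (Subspace.dual_finrank_eq (K := ℝ) (V := harmonic n ℓ)).symm).1 hB (Λ f hf)
  exact ⟨q, q.2, fun p hp => (LinearMap.congr_fun hq ⟨p, hp⟩).symm⟩

end Evaluation

/-! ### Polynomial moments determine functions -/

section Density

variable {α : Type*} [MeasurableSpace α] {ν : Measure α} {ι : α → Space n} {f : α → ℝ}

/-- The map `ι` lets one argument serve both measures: it is the identity for the ball and the
inclusion for the sphere. -/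
lemma integrable_mul_comp (hf : Integrable f ν) (hι : Measurable ι)
    (hb : ∀ᵐ a ∂ν, ι a ∈ closedBall (0 : Space n) 1) {φ : Space n → ℝ} (hφ : Continuous φ) :
    Integrable (fun a => f a * φ (ι a)) ν := by
  obtain ⟨C, hC⟩ := (isCompact_closedBall (0 : Space n) 1).exists_bound_of_continuousOn
    hφ.continuousOn
  exact hf.mul_bdd (c := C) (hφ.measurable.comp hι).aestronglyMeasurable
    (hb.mono fun a ha => hC _ ha)

lemma integral_mul_ev_eq_zero (hn : 1 ≤ n) (hf : Integrable f ν) (hι : Measurable ι)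
    (hb : ∀ᵐ a ∂ν, ι a ∈ closedBall (0 : Space n) 1)
    (h : ∀ j ℓ, ∀ p ∈ harmonic n ℓ, ∫ a, f a * ev (normSq n ^ j * p) (ι a) ∂ν = 0)
    (p : MvPolynomial (Fin n) ℝ) : ∫ a, f a * ev p (ι a) ∂ν = 0 := by
  have hint := fun p => integrable_mul_comp hf hι hb (continuous_ev p)
  let L : MvPolynomial (Fin n) ℝ →ₗ[ℝ] ℝ :=
    { toFun := fun p => ∫ a, f a * ev p (ι a) ∂ν
      map_add' := fun p q => by
        simp only [ev_add, mul_add]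
        exact integral_add (hint _) (hint _)
      map_smul' := fun c p => by
        simp only [ev_smul, RingHom.id_apply, smul_eq_mul, mul_left_comm _ c]
        exact integral_const_mul _ _ }
  exact LinearMap.congr_fun (linearMap_ext_harmonic hn (L := L) h) p

/-- Stone-Weierstrass: the coordinate functions separate points. -/
lemma exists_ev_near {φ : Space n → ℝ} (hφ : Continuous φ) {ε : ℝ} (hε : 0 < ε) :
    ∃ p, ∀ x ∈ closedBall (0 : Space n) 1, ‖ev p x - φ x‖ < ε := by
  let c : MvPolynomial (Fin n) ℝ →ₐ[ℝ] C(Space n, ℝ) :=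
    MvPolynomial.aeval fun i => ⟨fun x : Space n => x i, by fun_prop⟩
  have hc : ∀ p x, c p x = ev p x := by
    intro p x
    induction p using MvPolynomial.induction_on with
    | C a => simp [c, ev]
    | add p q hp hq => simp [hp, hq]
    | mul_X p i hp => rw [map_mul, ContinuousMap.mul_apply, hp]; simp [c, ev]
  have hsep : c.range.SeparatesPoints := by
    intro x y hxy
    obtain ⟨i, hi⟩ : ∃ i, x i ≠ y i := by
      by_contra! h
      exact hxy (PiLp.ext h)
    exact ⟨_, ⟨_, ⟨MvPolynomial.X i, rfl⟩, rfl⟩, by simpa [c] using hi⟩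
  obtain ⟨g, ⟨p, rfl⟩, hg⟩ :=
    ContinuousMap.exists_mem_subalgebra_near_continuous_of_isCompact_of_separatesPoints hsep
      ⟨φ, hφ⟩ (isCompact_closedBall (0 : Space n) 1) hε
  exact ⟨p, fun x hx => by simpa [hc] using hg x hx⟩

lemma integral_mul_continuous_eq_zero (hf : Integrable f ν) (hι : Measurable ι)
    (hb : ∀ᵐ a ∂ν, ι a ∈ closedBall (0 : Space n) 1)
    (h : ∀ p, ∫ a, f a * ev p (ι a) ∂ν = 0) {φ : Space n → ℝ} (hφ : Continuous φ) :
    ∫ a, f a * φ (ι a) ∂ν = 0 := by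
  have key : ∀ ε : ℝ, 0 < ε → ‖∫ a, f a * φ (ι a) ∂ν‖ ≤ ε * ∫ a, ‖f a‖ ∂ν := by
    intro ε hε
    obtain ⟨p, hp⟩ := exists_ev_near hφ hε
    have h1 : ∫ a, f a * φ (ι a) ∂ν = ∫ a, f a * φ (ι a) - f a * ev p (ι a) ∂ν := by
      rw [integral_sub (integrable_mul_comp hf hι hb hφ)
        (integrable_mul_comp hf hι hb (continuous_ev p)), h, sub_zero]
    rw [h1, ← integral_const_mul]
    refine norm_integral_le_of_norm_le (hf.norm.const_mul ε) (hb.mono fun a ha => ?_)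
    rw [← mul_sub, norm_mul, mul_comm, norm_sub_rev]
    exact mul_le_mul_of_nonneg_right (hp _ ha).le (norm_nonneg _)
  have h0 : ‖∫ a, f a * φ (ι a) ∂ν‖ ≤ 0 := by
    have ht : Tendsto (fun ε : ℝ => ε * ∫ a, ‖f a‖ ∂ν) (𝓝[>] 0) (𝓝 0) := by
      have : Tendsto (fun ε : ℝ => ε * ∫ a, ‖f a‖ ∂ν) (𝓝 0) (𝓝 (0 * ∫ a, ‖f a‖ ∂ν)) :=
        tendsto_id.mul_const _
      rw [zero_mul] at this
      exact this.mono_left nhdsWithin_le_nhds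
    exact ge_of_tendsto ht (by filter_upwards [self_mem_nhdsWithin] with ε hε using key ε hε)
  exact norm_le_zero_iff.1 h0

lemma ae_mem_closedBall : ∀ᵐ x ∂ballMeasure n, x ∈ closedBall (0 : Space n) 1 :=
  (ae_restrict_mem measurableSet_ball).mono fun _ h => ball_subset_closedBall h

lemma sphere_mem_closedBall :
    ∀ᵐ θ : Sphere n ∂sphereMeasure n, (θ : Space n) ∈ closedBall (0 : Space n) 1 :=
  ae_of_all _ fun θ => sphere_subset_closedBall θ.2

lemma ae_eq_zero_of_moments {f : Space n → ℝ} (hf : Integrable f (ballMeasure n))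
    (h : ∀ p, ∫ x, f x * ev p x ∂ballMeasure n = 0) : f =ᵐ[ballMeasure n] 0 := by
  have hloc : LocallyIntegrableOn f (ball (0 : Space n) 1) :=
    IntegrableOn.locallyIntegrableOn (show IntegrableOn f (ball (0 : Space n) 1) volume from hf)
  have := isOpen_ball.ae_eq_zero_of_integral_contDiff_smul_eq_zero hloc fun g hg _ hgp => by
    have h0 := integral_mul_continuous_eq_zero (ι := id) hf measurable_id ae_mem_closedBall h
      hg.continuous
    rw [ballMeasure, setIntegral_eq_integral_of_forall_compl_eq_zero fun x hx => by
      rw [id, image_eq_zero_of_notMem_tsupport fun h => hx (hgp h), mul_zero]] at h0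
    simpa [mul_comm] using h0
  exact (ae_restrict_iff' measurableSet_ball).2 this

end Density

/-! ### Spherical harmonics are restrictions of harmonic polynomials -/

section SphericalHarmonics

open MvPolynomial

variable {ℓ m : ℕ}

lemma radialExt_smul (Y : Sphere n → ℝ) {r : ℝ} (hr : 0 < r) (θ : Sphere n) :
    radialExt Y (r • (θ : Space n)) = Y θ := by
  have h0 : r • (θ : Space n) ≠ 0 := smul_ne_zero hr.ne' (ne_zero_of_mem_unit_sphere θ)
  rw [radialExt, dif_neg h0]
  congr 1
  ext1
  simp [norm_smul, abs_of_pos hr, smul_smul, hr.ne']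

lemma radialExt_coe (Y : Sphere n → ℝ) (θ : Sphere n) : radialExt Y (θ : Space n) = Y θ := by
  simpa using radialExt_smul Y one_pos θ

lemma radialExt_ev {p : MvPolynomial (Fin n) ℝ} (hp : p.IsHomogeneous ℓ) {x : Space n}
    (hx : x ≠ 0) : radialExt (fun θ : Sphere n => ev p θ) x = (‖x‖⁻¹) ^ ℓ * ev p x := by
  rw [radialExt, dif_neg hx, ev_smul_arg hp]

/-- The result is a combination of functions of the original form `|x|^(-k) p`, so the rule can be
applied again for second derivatives. -/
lemma partialDeriv_norm_inv_pow_mul (p : MvPolynomial (Fin n) ℝ) (k : ℕ) (i : Fin n) {x : Space n}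
    (hx : x ≠ 0) : DifferentiableAt ℝ (fun y : Space n => (‖y‖⁻¹) ^ k * ev p y) x ∧
      partialDeriv i (fun y : Space n => (‖y‖⁻¹) ^ k * ev p y) x =
      -k * ((‖x‖⁻¹) ^ (k + 2) * ev (X i * p) x) + (‖x‖⁻¹) ^ k * ev (pderiv i p) x := by
  have hx' := norm_ne_zero_iff.2 hx
  have h1 : HasDerivAt (fun r : ℝ => (r⁻¹) ^ k) (-k * (‖x‖⁻¹) ^ (k + 1)) ‖x‖ := by
    convert! (hasDerivAt_inv hx').pow k using 1
    rcases k with _ | k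
    · simp
    · simp only [Nat.add_sub_cancel, inv_pow, pow_succ]
      field_simp
  have h2 := partialDeriv_comp_norm hx h1 i
  have h3 := differentiable_of_smooth (contDiff_ev p) x
  refine ⟨h2.1.fun_mul h3, ?_⟩
  rw [partialDeriv_mul h2.1 h3, h2.2, partialDeriv_ev]
  simp [ev]
  ring

lemma partialDeriv_congr {f g : Space n → ℝ} {x : Space n} (h : f =ᶠ[𝓝 x] g) (i : Fin n) :
    partialDeriv i f =ᶠ[𝓝 x] partialDeriv i g :=
  (h.fderiv (𝕜 := ℝ)).mono fun y hy => by simp [partialDeriv, hy]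

/-- Homogeneous harmonic polynomials restrict to spherical harmonics. -/
lemma isSphericalHarmonic_ev {p : MvPolynomial (Fin n) ℝ} (hp : p ∈ harmonic n ℓ) :
    IsSphericalHarmonic ℓ (fun θ : Sphere n => ev p θ) := by
  have hph := isHomogeneous_of_mem_harmonic hp
  have hsm : ContDiffOn ℝ ∞ (radialExt fun θ : Sphere n => ev p θ) {0}ᶜ := by
    refine ContDiffOn.congr (f := fun y : Space n => (‖y‖⁻¹) ^ ℓ * ev p y) ?_
      fun x hx => radialExt_ev hph hx
    intro x hx
    have hx' : ‖x‖ ≠ 0 := norm_ne_zero_iff.2 hx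
    exact ((((contDiffAt_norm ℝ hx).inv hx').pow ℓ).mul
      (contDiff_ev p).contDiffAt).contDiffWithinAt
  refine ⟨hsm, fun θ => ?_⟩
  have hθ : (θ : Space n) ≠ 0 := ne_zero_of_mem_unit_sphere θ
  have hne : ∀ᶠ y in 𝓝 (θ : Space n), y ≠ 0 := isOpen_ne.mem_nhds hθ
  have h1 : radialExt (fun θ : Sphere n => ev p θ) =ᶠ[𝓝 (θ : Space n)]
      fun y => (‖y‖⁻¹) ^ ℓ * ev p y := hne.mono fun y hy => radialExt_ev hph hy
  rw [laplaceBeltrami, laplacian_eq_sum ((hsm.contDiffAt (isOpen_compl_singleton.mem_nhds hθ)).of_le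
    (by norm_cast))]
  have h2 : ∀ i, partialDeriv i (partialDeriv i (radialExt fun θ : Sphere n => ev p θ)) θ =
      ℓ * (ℓ + 2) * ((θ : Space n) i ^ 2 * ev p θ) - ℓ * ev p θ
        - 2 * ℓ * ((θ : Space n) i * ev (pderiv i p) θ) + ev (pderiv i (pderiv i p)) θ := by
    intro i
    have h3 : partialDeriv i (radialExt fun θ : Sphere n => ev p θ) =ᶠ[𝓝 (θ : Space n)]
        fun y => -ℓ * ((‖y‖⁻¹) ^ (ℓ + 2) * ev (X i * p) y) + (‖y‖⁻¹) ^ ℓ * ev (pderiv i p) y :=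
      (partialDeriv_congr h1 i).trans
        (hne.mono fun y hy => (partialDeriv_norm_inv_pow_mul p ℓ i hy).2)
    rw [(partialDeriv_congr h3 i).eq_of_nhds]
    have h4 := partialDeriv_norm_inv_pow_mul (X i * p) (ℓ + 2) i hθ
    have h5 := partialDeriv_norm_inv_pow_mul (pderiv i p) ℓ i hθ
    have h6 := h4.2
    have h7 := h5.2
    unfold partialDeriv at h6 h7 ⊢
    rw [fderiv_fun_add (h4.1.const_mul _) h5.1, fderiv_const_mul h4.1]
    simp only [add_apply, smul_apply, h6, h7]
    simp [ev, norm_eq_of_mem_sphere]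
    ring
  -- Summing over `i` with `|θ| = 1`, Euler's identity and `Δp = 0` leaves `ℓ(ℓ+2) - nℓ - 2ℓ² =
  -- -ℓ(ℓ+n-2)` times `p`.
  have he := congrArg (fun q => ev q θ) hph.sum_X_mul_pderiv
  have hl := congrArg (fun q => ev q θ) (polyLaplacian_of_mem_harmonic hp)
  have hnorm : ∑ i, (θ : Space n) i ^ 2 = 1 := by
    rw [← EuclideanSpace.real_norm_sq_eq, norm_eq_of_mem_sphere, one_pow]
  simp only [polyLaplacian_apply] at hl
  have he' : ∑ i, (θ : Space n) i * ev (pderiv i p) θ = ℓ * ev p θ := by simpa [ev] using he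
  have hl' : ∑ i, ev (pderiv i (pderiv i p)) θ = 0 := by simpa [ev] using hl
  simp only [h2, Finset.sum_add_distrib, Finset.sum_sub_distrib, ← Finset.mul_sum,
    ← Finset.sum_mul, hnorm, he', hl', Finset.sum_const, Finset.card_univ, Fintype.card_fin,
    nsmul_eq_mul]
  ring

/-- A smooth function on the sphere is the restriction of a smooth function on `ℝⁿ` which is
constant along rays away from the origin. -/
lemma exists_smooth_extension {Y : Sphere n → ℝ} (hY : ContDiffOn ℝ ∞ (radialExt Y) {0}ᶜ) :
    ∃ W : Space n → ℝ, ContDiff ℝ ∞ W ∧ ∀ x : Space n, 1 / 2 < ‖x‖ → W x = radialExt Y x := by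
  let b : ContDiffBump (0 : Space n) := ⟨1 / 4, 1 / 2, by norm_num, by norm_num⟩
  refine ⟨fun x => (1 - b x) * radialExt Y x, contDiff_iff_contDiffAt.2 fun x => ?_, fun x hx => ?_⟩
  · rcases eq_or_ne x 0 with rfl | hx
    · refine (contDiffAt_const (c := (0 : ℝ))).congr_of_eventuallyEq ?_
      filter_upwards [closedBall_mem_nhds (0 : Space n) b.rIn_pos] with y hy
      rw [b.one_of_mem_closedBall hy, sub_self, zero_mul]
    · exact (contDiffAt_const.sub b.contDiffAt).mul
        (hY.contDiffAt (isOpen_compl_singleton.mem_nhds hx))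
  · beta_reduce
    rw [b.zero_of_le_dist (by simpa [b] using hx.le), sub_zero, one_mul]

/-- Let `c` be the integral and `W` the extension of `Y` constant along rays near the sphere. The
flux of `W ∇p - p ∇W` through the sphere of radius `r` is `m c r^(n-2+m)`, because `W` has no radial
derivative. Its derivative at `r = 1` is also the surface integral of `-p ΔW`, that is `ℓ(ℓ+n-2) c`.
-/
lemma integral_sphericalHarmonic_mul_ev (hn : 2 ≤ n) {Y : Sphere n → ℝ}
    (hY : IsSphericalHarmonic ℓ Y) {p : MvPolynomial (Fin n) ℝ} (hp : p ∈ harmonic n m)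
    (hlm : m ≠ ℓ) : ∫ θ, Y θ * ev p θ ∂sphereMeasure n = 0 := by
  obtain ⟨W, hW, hWY⟩ := exists_smooth_extension hY.1
  have hph := isHomogeneous_of_mem_harmonic hp
  have hW' : ∀ (θ : Sphere n) (r : ℝ), 1 / 2 < r → W (r • (θ : Space n)) = Y θ := by
    intro θ r hr
    have h0 : 0 < r := by linarith
    rw [hWY _ (by simpa [norm_smul, abs_of_pos h0] using hr), radialExt_smul Y h0]
  have hWd : ∀ (θ : Sphere n) (r : ℝ), 1 / 2 < r →
      fderiv ℝ W (r • (θ : Space n)) (θ : Space n) = 0 := by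
    intro θ r hr
    have h1 : HasDerivAt (fun t : ℝ => t • (θ : Space n)) (θ : Space n) r := by
      simpa using (hasDerivAt_id r).smul_const (θ : Space n)
    have h2 := (differentiable_of_smooth hW (r • (θ : Space n))).hasFDerivAt.comp_hasDerivAt r h1
    refine h2.unique ((hasDerivAt_const r (Y θ)).congr_of_eventuallyEq ?_)
    filter_upwards [lt_mem_nhds hr] with t ht using hW' θ t ht
  set c := ∫ θ, Y θ * ev p θ ∂sphereMeasure n with hc
  have hflux : ∀ r : ℝ, 1 / 2 < r →
      flux (greenField W (ev p)) r = r ^ (n - 2 + m) * (m * c) := by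
    intro r hr
    have h0 : r ≠ 0 := by linarith
    have h1 : ∀ θ : Sphere n, fderiv ℝ (ev p) (r • (θ : Space n)) (θ : Space n)
        = r⁻¹ * (m * (r ^ m * ev p θ)) := by
      intro θ
      rw [← ev_smul_arg hph, ← fderiv_ev_self hph, map_smul, smul_eq_mul, inv_mul_cancel_left₀ h0]
    rw [flux]
    simp only [sum_mul_greenField, hWd _ r hr, hW' _ r hr, h1, mul_zero, sub_zero]
    have h2 : ∀ θ : Sphere n, Y θ * (r⁻¹ * (m * (r ^ m * ev p θ))) =
        (r⁻¹ * m * r ^ m) * (Y θ * ev p θ) := fun θ => by ring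
    simp only [h2, integral_const_mul, ← hc]
    obtain ⟨k, rfl⟩ := Nat.exists_eq_add_of_le' hn
    simp only [Nat.add_sub_cancel, pow_add, show k + 2 - 1 = k + 1 by omega]
    field_simp
  have hd1 := hasDerivAt_flux (by omega) (F := greenField W (ev p))
    (fun i => (contDiff_greenField hW (contDiff_ev p) i).of_le (by norm_cast)) one_pos
  have hd2 : HasDerivAt (flux (greenField W (ev p))) (((n - 2 + m : ℕ) : ℝ) * (m * c)) 1 := by
    have := (hasDerivAt_pow (n - 2 + m) (1 : ℝ)).mul_const (m * c)
    rw [one_pow, mul_one] at this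
    refine this.congr_of_eventuallyEq ?_
    filter_upwards [lt_mem_nhds (show (1 : ℝ) / 2 < 1 by norm_num)] with r hr using hflux r hr
  have heq := hd1.unique hd2
  have hΔ : ∀ θ : Sphere n, Δ W (θ : Space n) = - (ℓ * (ℓ + n - 2) * Y θ) := by
    intro θ
    rw [← hY.2 θ, neg_neg, laplaceBeltrami]
    refine InnerProductSpace.laplacian_congr_nhds ?_ |>.eq_of_nhds
    have : ∀ᶠ x in 𝓝 (θ : Space n), 1 / 2 < ‖x‖ :=
      continuous_norm.continuousAt.eventually (lt_mem_nhds (by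
        change 1 / 2 < ‖(θ : Space n)‖
        rw [norm_eq_of_mem_sphere]; norm_num))
    exact this.mono hWY
  rw [divergence_greenField hW (contDiff_ev p), laplacian_ev, polyLaplacian_of_mem_harmonic hp,
    one_pow, one_mul, sphereIntegral] at heq
  have h3 : ∀ θ : Sphere n, ev p θ * Δ W θ = -(ℓ * (ℓ + n - 2)) * (Y θ * ev p θ) := fun θ => by
    rw [hΔ]; ring
  simp only [one_smul, h3, ev_zero, Pi.zero_apply, mul_zero, zero_sub, integral_neg,
    integral_const_mul, ← hc] at heq
  push_cast [Nat.cast_sub hn] at heq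
  -- The difference of `ℓ(ℓ+n-2)` and `m(m+n-2)`, factored. The second factor is positive because `n
  -- ≥ 2` and distinct orders have `ℓ + m ≥ 1`.
  have h4 : ((ℓ : ℝ) - m) * (ℓ + m + n - 2) * c = 0 := by linear_combination heq
  have h5 : ((ℓ : ℝ) - m) * (ℓ + m + n - 2) ≠ 0 := by
    have hn' : (2 : ℝ) ≤ n := by exact_mod_cast hn
    refine mul_ne_zero (sub_ne_zero.2 (by exact_mod_cast hlm.symm)) ?_
    have : (1 : ℝ) ≤ ℓ + m := by exact_mod_cast (by omega : 1 ≤ ℓ + m)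
    linarith
  exact (mul_eq_zero.1 h4).resolve_left h5

/-- Spherical harmonics are restrictions of homogeneous harmonic polynomials. -/
lemma IsSphericalHarmonic.exists_ev (hn : 2 ≤ n) {Y : Sphere n → ℝ}
    (hY : IsSphericalHarmonic ℓ Y) : ∃ p ∈ harmonic n ℓ, Y = fun θ : Sphere n => ev p θ := by
  obtain ⟨W, hW, hWY⟩ := exists_smooth_extension hY.1
  have hW' : ∀ θ : Sphere n, W θ = Y θ := fun θ => by
    rw [hWY _ (by rw [norm_eq_of_mem_sphere]; norm_num), radialExt_coe]
  have hYc : Continuous Y := (hW.continuous.comp continuous_subtype_val).congr hW'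
  have hn1 : 1 ≤ n := by omega
  obtain ⟨q, hq, hqp⟩ := exists_harmonic_projection hn1 ℓ (integrable_sphere hYc)
  refine ⟨q, hq, ?_⟩
  have hqc : Continuous fun θ : Sphere n => ev q θ := (continuous_ev q).comp continuous_subtype_val
  have hZc : Continuous fun θ : Sphere n => Y θ - ev q θ := hYc.sub hqc
  -- In order `ℓ` the moments vanish by the choice of `q`; in the other orders both terms vanish by
  -- orthogonality.
  have hmom : ∀ p : MvPolynomial (Fin n) ℝ, ∫ θ : Sphere n, (Y θ - ev q θ) * ev p θ ∂sphereMeasure n = 0 := by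
    refine integral_mul_ev_eq_zero hn1 (integrable_sphere hZc) measurable_subtype_coe
      sphere_mem_closedBall fun j m p hp => ?_
    have hpc : Continuous fun θ : Sphere n => ev p θ :=
      (continuous_ev p).comp continuous_subtype_val
    simp only [ev_normSq_pow_mul, norm_eq_of_mem_sphere, one_pow, one_mul, sub_mul]
    rw [integral_sub (integrable_sphere (hYc.fun_mul hpc)) (integrable_sphere (hqc.fun_mul hpc))]
    rcases eq_or_ne m ℓ with rfl | hm
    · rw [hqp p hp, sub_self]
    · rw [integral_sphericalHarmonic_mul_ev hn hY hp hm,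
        integral_sphericalHarmonic_mul_ev hn (isSphericalHarmonic_ev hq) hp hm, sub_self]
  -- The test function `W - q` restricts to `Y - q`, so this says `∫ (Y - q)² = 0`.
  have h0 := integral_mul_continuous_eq_zero (integrable_sphere hZc) measurable_subtype_coe
    sphere_mem_closedBall hmom (hW.continuous.sub (continuous_ev q))
  simp only [Pi.sub_apply, hW'] at h0
  rw [integral_eq_zero_iff_of_nonneg (fun θ => mul_self_nonneg _)
    (integrable_sphere (hZc.mul hZc))] at h0
  replace h0 := (Continuous.ae_eq_iff_eq _ (hZc.fun_mul hZc) continuous_zero).1 h0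
  funext θ
  exact sub_eq_zero.1 (mul_self_eq_zero.1 (congrFun h0 θ))

end SphericalHarmonics

/-! ### Smooth functions in `H²`, traces and Green's identity -/

section Sobolev

lemma memLp_ball {f : Space n → ℝ} (hf : Continuous f) : MemLp f 2 (ballMeasure n) := by
  obtain ⟨C, hC⟩ := (isCompact_closedBall (0 : Space n) 1).exists_bound_of_continuousOn
    hf.continuousOn
  exact MemLp.of_bound hf.aestronglyMeasurable C (ae_mem_closedBall.mono fun x hx => hC x hx)

lemma memLp_sphere {f : Sphere n → ℝ} (hf : Continuous f) : MemLp f 2 (sphereMeasure n) := by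
  obtain ⟨C, hC⟩ := (isCompact_univ (X := Sphere n)).exists_bound_of_continuousOn hf.continuousOn
  exact MemLp.of_bound hf.aestronglyMeasurable C (ae_of_all _ fun x => hC x (Set.mem_univ x))

/-- The function `u` is kept apart from its smooth representative `w` because an eigenfunction may
be altered on a null set. -/
lemma isWeakPartial_partialDeriv {w u : Space n → ℝ} (hw : ContDiff ℝ 1 w)
    (hu : u =ᵐ[ballMeasure n] w) (i : Fin n) : IsWeakPartial i u (partialDeriv i w) := by
  intro φ hφ hφs hφb
  have h0 : ∀ x, x ∉ ball (0 : Space n) 1 → φ x = 0 := fun x hx =>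
    image_eq_zero_of_notMem_tsupport fun h => hx (hφb h)
  have h1 : ∀ x, x ∉ ball (0 : Space n) 1 → partialDeriv i φ x = 0 := fun x hx => by
    have : fderiv ℝ φ x = 0 := image_eq_zero_of_notMem_tsupport fun h =>
      hx (hφb (tsupport_fderiv_subset ℝ h))
    simp [partialDeriv, this]
  have hc1 := continuous_partialDeriv hw i
  have hc2 : Continuous (partialDeriv i φ) := (contDiff_partialDeriv hφ i).continuous
  have hs2 : HasCompactSupport (partialDeriv i φ) :=
    hφs.fderiv_apply (𝕜 := ℝ) (EuclideanSpace.single i 1)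
  rw [integral_congr_ae (g := fun x => w x * partialDeriv i φ x)
    (hu.mono fun x hx => by simp only [hx]), ballMeasure,
    setIntegral_eq_integral_of_forall_compl_eq_zero fun x hx => by rw [h1 x hx, mul_zero],
    setIntegral_eq_integral_of_forall_compl_eq_zero fun x hx => by rw [h0 x hx, mul_zero]]
  exact integral_mul_fderiv_eq_neg_fderiv_mul_of_integrable
    ((hc1.mul hφ.continuous).integrable_of_hasCompactSupport hφs.mul_left)
    ((hw.continuous.mul hc2).integrable_of_hasCompactSupport hs2.mul_left)
    ((hw.continuous.mul hφ.continuous).integrable_of_hasCompactSupport hφs.mul_left)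
    (fun x _ => hw.differentiable (by simp) x) (fun x _ => differentiable_of_smooth hφ x)

/-- A function which agrees almost everywhere in the ball with a smooth function, as an element
of `H²`. -/
def H2.ofSmooth (u w : Space n → ℝ) (hw : ContDiff ℝ ∞ w) (hu : u =ᵐ[ballMeasure n] w) : H2 n where
  val := u
  grad i := partialDeriv i w
  hess i j := partialDeriv j (partialDeriv i w)
  memLp_val := (memLp_congr_ae hu).2 (memLp_ball hw.continuous)
  memLp_grad i := memLp_ball (contDiff_partialDeriv hw i).continuous
  memLp_hess i j := memLp_ball (contDiff_partialDeriv (contDiff_partialDeriv hw i) j).continuous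
  weak_grad i := isWeakPartial_partialDeriv (hw.of_le (by norm_cast)) hu i
  weak_hess i j := isWeakPartial_partialDeriv
    ((contDiff_partialDeriv hw i).of_le (by norm_cast)) (EventuallyEq.refl _ _) j

variable {u w : Space n → ℝ} {hw : ContDiff ℝ ∞ w} {hu : u =ᵐ[ballMeasure n] w}

lemma laplacian_ofSmooth : (H2.ofSmooth u w hw hu).laplacian = Δ w := by
  rw [laplacian_eq_sum' hw]
  rfl

lemma hasTraces_ofSmooth : HasTraces (H2.ofSmooth u w hw hu) (fun θ => w θ) (normalDeriv w) := by
  refine ⟨memLp_sphere (hw.continuous.comp continuous_subtype_val),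
    memLp_sphere (continuous_normalDeriv hw), fun _ => w, fun _ => hw, ⟨?_, ?_, ?_⟩, ?_, ?_⟩
  · have : eLpNorm (fun x => w x - u x) 2 (ballMeasure n) = 0 := by
      rw [eLpNorm_congr_ae (g := 0) (hu.mono fun x hx => by simp [hx]), eLpNorm_zero]
    simp [H2.ofSmooth, this]
  all_goals simp [H2.ofSmooth]

lemma tendsto_integral_mul {α : Type*} [MeasurableSpace α] {ν : Measure α} {φ : ℕ → α → ℝ}
    {f w : α → ℝ} (hφ : ∀ k, MemLp (φ k) 2 ν) (hf : MemLp f 2 ν) (hw : MemLp w 2 ν)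
    (h : Tendsto (fun k => eLpNorm (fun a => φ k a - f a) 2 ν) atTop (𝓝 0)) :
    Tendsto (fun k => ∫ a, φ k a * w a ∂ν) atTop (𝓝 (∫ a, f a * w a ∂ν)) := by
  refine tendsto_integral_of_L1' _ (hf.integrable_mul hw).aestronglyMeasurable
    (Eventually.of_forall fun k => (hφ k).integrable_mul hw) ?_
  have hb : ∀ k, eLpNorm ((fun a => φ k a * w a) - fun a => f a * w a) 1 ν ≤
      eLpNorm (fun a => φ k a - f a) 2 ν * eLpNorm w 2 ν := by
    intro k
    have := eLpNorm_smul_le_mul_eLpNorm (p := 2) (q := 2) (r := 1) hw.1 ((hφ k).sub hf).1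
    refine le_trans (le_of_eq ?_) this
    congr 1
    ext a
    simp [sub_mul]
  have ht : Tendsto (fun k => eLpNorm (fun a => φ k a - f a) 2 ν * eLpNorm w 2 ν) atTop (𝓝 0) := by
    have := ENNReal.Tendsto.mul_const h (Or.inr hw.2.ne)
    rwa [zero_mul] at this
  exact tendsto_of_tendsto_of_tendsto_of_le_of_le tendsto_const_nhds ht (fun _ => bot_le) hb

/-- Green's second identity for an `H²` function and a smooth function. -/
lemma HasTraces.green (hn : 1 ≤ n) {U : H2 n} {g₀ g₁ : Sphere n → ℝ} (hU : HasTraces U g₀ g₁)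
    {w : Space n → ℝ} (hw : ContDiff ℝ ∞ w) :
    ∫ x, U.laplacian x * w x ∂ballMeasure n = ∫ x, U.val x * Δ w x ∂ballMeasure n
      - ∫ θ : Sphere n, g₀ θ * normalDeriv w θ ∂sphereMeasure n
      + ∫ θ : Sphere n, g₁ θ * w θ ∂sphereMeasure n := by
  obtain ⟨hg₀, hg₁, φ, hφ, ⟨h0, -, h2⟩, h3, h4⟩ := hU
  have hΔc := (contDiff_laplacian hw).continuous
  have hc : ∀ k i, Continuous (partialDeriv i (partialDeriv i (φ k))) := fun k i =>
    (contDiff_partialDeriv (contDiff_partialDeriv (hφ k) i) i).continuous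
  have hws : Continuous fun θ : Sphere n => w θ := hw.continuous.comp continuous_subtype_val
  have t0 := tendsto_integral_mul (fun k => memLp_ball (hφ k).continuous) U.memLp_val
    (memLp_ball hΔc) h0
  have t3 := tendsto_integral_mul
    (fun k => memLp_sphere ((hφ k).continuous.comp continuous_subtype_val)) hg₀
    (memLp_sphere (continuous_normalDeriv hw)) h3
  have t4 := tendsto_integral_mul (fun k => memLp_sphere (continuous_normalDeriv (hφ k))) hg₁
    (memLp_sphere hws) h4
  have t2 := tendsto_finsetSum Finset.univ fun i _ => tendsto_integral_mul
    (fun k => memLp_ball (hc k i)) (U.memLp_hess i i) (memLp_ball hw.continuous) (h2 i i)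
  have e1 : ∫ x, U.laplacian x * w x ∂ballMeasure n =
      ∑ i, ∫ x, U.hess i i x * w x ∂ballMeasure n := by
    simp only [H2.laplacian, Finset.sum_mul]
    exact integral_finsetSum _ fun i _ =>
      (U.memLp_hess i i).integrable_mul (memLp_ball hw.continuous)
  have e2 : ∀ k, ∑ i, ∫ x, partialDeriv i (partialDeriv i (φ k)) x * w x ∂ballMeasure n =
      ∫ x, Δ (φ k) x * w x ∂ballMeasure n := by
    intro k
    rw [laplacian_eq_sum' (hφ k)]
    simp only [Finset.sum_mul]
    exact (integral_finsetSum _ fun i _ => integrable_ball ((hc k i).mul hw.continuous)).symm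
  simp only [e2] at t2
  rw [e1]
  -- The smooth approximants from the definition of traces satisfy Green's identity, and every term
  -- of it passes to the limit.
  refine tendsto_nhds_unique t2 (((t0.sub t3).add t4).congr fun k => ?_)
  exact (BiharmonicSteklov.green hn (hφ k) hw).symm

/-- Classical solutions are weak solutions. -/
lemma weak_of_classical (hn : 1 ≤ n) {μ : ℝ} {w : Space n → ℝ} (hw : IsClassicalSolution μ w)
    (V : H2 n) (h : Sphere n → ℝ) (hV : HasTraces V h 0) :
    ∫ x, Δ w x * V.laplacian x ∂ballMeasure n = μ * ∫ θ : Sphere n, w θ * h θ ∂sphereMeasure n := by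
  obtain ⟨hws, h1, -, h3⟩ := hw
  -- Green's identity for `V` against `Δw`: the interior term vanishes by `Δ²w = 0`, one boundary
  -- term by `∂_ν V = 0`.
  have hg := hV.green hn (contDiff_laplacian hws)
  have e1 : ∫ x, V.val x * Δ (Δ w) x ∂ballMeasure n = 0 := by
    rw [ballMeasure]
    exact setIntegral_eq_zero_of_forall_eq_zero fun x hx => by rw [h1 x hx, mul_zero]
  have e2 : ∀ θ : Sphere n, h θ * normalDeriv (Δ w) θ = -(μ * (w θ * h θ)) := fun θ => by
    rw [← mul_assoc, ← h3 θ]; ring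
  simp only [e1, e2, integral_neg, integral_const_mul, Pi.zero_apply, zero_mul,
    integral_zero] at hg
  simp only [mul_comm (Δ w _), hg]
  ring

lemma isWeakSolution_ofSmooth (hn : 1 ≤ n) {μ : ℝ} (h : IsClassicalSolution μ w) :
    IsWeakSolution μ (H2.ofSmooth u w hw hu) := by
  have hT := hasTraces_ofSmooth (hw := hw) (hu := hu)
  rw [show normalDeriv w = 0 from funext h.2.2.1] at hT
  refine ⟨_, hT, fun V g hV => ?_⟩
  rw [laplacian_ofSmooth]
  exact weak_of_classical hn h V g hV

end Sobolev

/-! ### Moment identities for weak solutions -/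

section Moments

open MvPolynomial

variable {ℓ m : ℕ} {μ : ℝ}

/-- The identities obtained by testing a solution `u` with Laplacian `f` and boundary values `g`
against polynomials. -/
structure IsMomentSolution (μ : ℝ) (u f : Space n → ℝ) (g : Sphere n → ℝ) : Prop where
  integrable_val : Integrable u (ballMeasure n)
  integrable_lap : Integrable f (ballMeasure n)
  integrable_trace : Integrable g (sphereMeasure n)
  green : ∀ p, ∫ x, f x * ev p x ∂ballMeasure n =
    ∫ x, u x * ev (polyLaplacian p) x ∂ballMeasure n
      - ∫ θ, g θ * normalDeriv (ev p) θ ∂sphereMeasure n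
  weak : ∀ p : MvPolynomial (Fin n) ℝ, normalDeriv (ev p) = 0 →
    ∫ x, f x * ev (polyLaplacian p) x ∂ballMeasure n = μ * ∫ θ, g θ * ev p θ ∂sphereMeasure n

lemma integrable_ball_mul_ev {f : Space n → ℝ} (hf : Integrable f (ballMeasure n))
    (p : MvPolynomial (Fin n) ℝ) : Integrable (fun x => f x * ev p x) (ballMeasure n) :=
  integrable_mul_comp hf measurable_id ae_mem_closedBall (continuous_ev p)

lemma integrable_sphere_mul {g h : Sphere n → ℝ} (hg : Integrable g (sphereMeasure n))
    (hh : Continuous h) : Integrable (fun θ => g θ * h θ) (sphereMeasure n) := by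
  obtain ⟨C, hC⟩ := (isCompact_univ (X := Sphere n)).exists_bound_of_continuousOn hh.continuousOn
  exact hg.mul_bdd (c := C) hh.aestronglyMeasurable (ae_of_all _ fun x => hC x (Set.mem_univ x))

lemma continuous_ev_sphere (p : MvPolynomial (Fin n) ℝ) : Continuous fun θ : Sphere n => ev p θ :=
  (continuous_ev p).comp continuous_subtype_val

/-- Linearity for a fixed `μ`, used to subtract a mode from an eigenfunction. -/
lemma IsMomentSolution.sub {u₁ u₂ f₁ f₂ : Space n → ℝ} {g₁ g₂ : Sphere n → ℝ}
    (h₁ : IsMomentSolution μ u₁ f₁ g₁) (h₂ : IsMomentSolution μ u₂ f₂ g₂) :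
    IsMomentSolution μ (fun x => u₁ x - u₂ x) (fun x => f₁ x - f₂ x) (fun θ => g₁ θ - g₂ θ) where
  integrable_val := h₁.integrable_val.sub h₂.integrable_val
  integrable_lap := h₁.integrable_lap.sub h₂.integrable_lap
  integrable_trace := h₁.integrable_trace.sub h₂.integrable_trace
  green p := by
    have hc := continuous_normalDeriv (contDiff_ev p)
    simp only [sub_mul]
    rw [integral_sub (integrable_ball_mul_ev h₁.integrable_lap p)
      (integrable_ball_mul_ev h₂.integrable_lap p),
      integral_sub (integrable_ball_mul_ev h₁.integrable_val _)
      (integrable_ball_mul_ev h₂.integrable_val _),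
      integral_sub (integrable_sphere_mul h₁.integrable_trace hc)
      (integrable_sphere_mul h₂.integrable_trace hc), h₁.green, h₂.green]
    ring
  weak p hp := by
    have hc := continuous_ev_sphere p
    simp only [sub_mul]
    rw [integral_sub (integrable_ball_mul_ev h₁.integrable_lap _)
      (integrable_ball_mul_ev h₂.integrable_lap _),
      integral_sub (integrable_sphere_mul h₁.integrable_trace hc)
      (integrable_sphere_mul h₂.integrable_trace hc), h₁.weak p hp, h₂.weak p hp]
    ring

lemma isMomentSolution_of_weak (hn : 1 ≤ n) {U : H2 n} {g : Sphere n → ℝ} (hT : HasTraces U g 0)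
    (hW : ∀ (V : H2 n) (h : Sphere n → ℝ), HasTraces V h 0 →
      ∫ x, U.laplacian x * V.laplacian x ∂ballMeasure n = μ * ∫ θ, g θ * h θ ∂sphereMeasure n) :
    IsMomentSolution μ U.val U.laplacian g where
  integrable_val := U.memLp_val.integrable (by norm_num)
  integrable_lap := integrable_finsetSum _ fun i _ => (U.memLp_hess i i).integrable (by norm_num)
  integrable_trace := hT.1.integrable (by norm_num)
  green p := by
    rw [hT.green hn (contDiff_ev p), laplacian_ev]
    simp
  weak p hp := by
    have hV := hasTraces_ofSmooth (hw := contDiff_ev p) (hu := EventuallyEq.refl _ _)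
    rw [hp] at hV
    have := hW _ _ hV
    rwa [laplacian_ofSmooth, laplacian_ev] at this

lemma normalDeriv_ev_sub_smul {p q : MvPolynomial (Fin n) ℝ} {d e : ℕ} (hp : p.IsHomogeneous d)
    (hq : q.IsHomogeneous e) (c : ℝ) (θ : Sphere n) :
    normalDeriv (ev (p - c • q)) θ = d * ev p θ - c * (e * ev q θ) := by
  have h1 := differentiable_of_smooth (contDiff_ev p) (θ : Space n)
  have h2 := differentiable_of_smooth (contDiff_ev q) (θ : Space n)
  rw [ev_sub, ev_smul, normalDeriv, fderiv_fun_sub h1 (h2.const_mul c), fderiv_const_mul h2]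
  simp [fderiv_ev_self hp, fderiv_ev_self hq]

variable {u f : Space n → ℝ} {g : Sphere n → ℝ} {p : MvPolynomial (Fin n) ℝ}

lemma ev_normSq_pow_mul_sphere (j : ℕ) (p : MvPolynomial (Fin n) ℝ) (θ : Sphere n) :
    ev (normSq n ^ j * p) θ = ev p θ := by
  rw [ev_normSq_pow_mul, norm_eq_of_mem_sphere, one_pow, one_mul]

/-- Here `Δp = 0`, and `∂_ν p = ℓ p` on the sphere by Euler's identity. -/
lemma IsMomentSolution.green_harmonic (h : IsMomentSolution μ u f g) (hp : p ∈ harmonic n ℓ) :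
    ∫ x, f x * ev p x ∂ballMeasure n = -(ℓ * ∫ θ, g θ * ev p θ ∂sphereMeasure n) := by
  have := h.green p
  simpa [polyLaplacian_of_mem_harmonic hp, normalDeriv_ev (isHomogeneous_of_mem_harmonic hp),
    mul_left_comm _ (ℓ : ℝ), integral_const_mul] using this

lemma IsMomentSolution.green_normSq_pow (h : IsMomentSolution μ u f g) (hp : p ∈ harmonic n ℓ)
    (j : ℕ) : ∫ x, f x * ev (normSq n ^ (j + 1) * p) x ∂ballMeasure n =
      (2 * (j + 1) * (2 * j + 2 * ℓ + n)) * ∫ x, u x * ev (normSq n ^ j * p) x ∂ballMeasure n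
        - (2 * (j + 1) + ℓ) * ∫ θ, g θ * ev p θ ∂sphereMeasure n := by
  have := h.green (normSq n ^ (j + 1) * p)
  rw [polyLaplacian_normSq_pow_mul hp, ev_smul] at this
  have h1 := fun θ => normalDeriv_ev
    (isHomogeneous_normSq_pow_mul (isHomogeneous_of_mem_harmonic hp) (j + 1)) θ
  simp only [h1, ev_normSq_pow_mul_sphere, mul_left_comm (u _), mul_left_comm (g _),
    integral_const_mul] at this
  rw [this]
  push_cast
  ring

/-- Testing against `|x|^(2j+2) P - (2j+2+ℓ)/ℓ P`. -/
lemma IsMomentSolution.weak_of_pos (h : IsMomentSolution μ u f g) (hp : p ∈ harmonic n ℓ)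
    (hℓ : ℓ ≠ 0) (j : ℕ) :
    (2 * (j + 1) * (2 * j + 2 * ℓ + n)) * ∫ x, f x * ev (normSq n ^ j * p) x ∂ballMeasure n =
      - (μ * (2 * (j + 1) / ℓ) * ∫ θ, g θ * ev p θ ∂sphereMeasure n) := by
  have hℓ' : (ℓ : ℝ) ≠ 0 := by exact_mod_cast hℓ
  have hph := isHomogeneous_of_mem_harmonic hp
  -- The ratio of the two degrees, so that the normal derivatives cancel on the sphere, where both
  -- polynomials equal `p`.
  set c : ℝ := (2 * (j + 1) + ℓ) / ℓ with hc
  have := h.weak (normSq n ^ (j + 1) * p - c • p) (by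
    funext θ
    rw [normalDeriv_ev_sub_smul (isHomogeneous_normSq_pow_mul hph (j + 1)) hph,
      ev_normSq_pow_mul_sphere, hc, Pi.zero_apply]
    push_cast
    field_simp
    ring)
  rw [map_sub, map_smul, polyLaplacian_normSq_pow_mul hp, polyLaplacian_of_mem_harmonic hp,
    smul_zero, sub_zero] at this
  have h2 : ∀ θ : Sphere n, g θ * ev (normSq n ^ (j + 1) * p - c • p) θ =
      (1 - c) * (g θ * ev p θ) := fun θ => by
    rw [ev_sub, ev_smul]
    simp only [ev_normSq_pow_mul_sphere]
    ring
  simp only [h2, ev_smul, mul_left_comm (f _), integral_const_mul] at this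
  rw [this, hc]
  field_simp
  ring

/-- Testing against constants. -/
lemma IsMomentSolution.weak_of_zero (h : IsMomentSolution μ u f g) (hp : p ∈ harmonic n 0) :
    μ * ∫ θ, g θ * ev p θ ∂sphereMeasure n = 0 := by
  have := h.weak p (funext fun θ => by
    simp [normalDeriv_ev (isHomogeneous_of_mem_harmonic hp)])
  rw [← this]
  simp [polyLaplacian_of_mem_harmonic hp]

/-- Testing against `(|x|^(2j+2) - (j+1) |x|²) P` with `P` constant. -/
lemma IsMomentSolution.lap_moment_zero (hn : 1 ≤ n) (h : IsMomentSolution μ u f g)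
    (hp : p ∈ harmonic n 0) (hc : ∫ θ, g θ * ev p θ ∂sphereMeasure n = 0) (j : ℕ) :
    ∫ x, f x * ev (normSq n ^ j * p) x ∂ballMeasure n = 0 := by
  have hph := isHomogeneous_of_mem_harmonic hp
  -- A constant `p` has no normal derivative to cancel with, so `|x|² p` is the correction. Its
  -- Laplacian `2n p` contributes nothing, by `h0`.
  have h1 := h.weak (normSq n ^ (j + 1) * p - (j + 1 : ℝ) • (normSq n ^ (0 + 1) * p)) (by
    funext θ
    rw [normalDeriv_ev_sub_smul (isHomogeneous_normSq_pow_mul hph (j + 1))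
      (isHomogeneous_normSq_pow_mul hph (0 + 1)), ev_normSq_pow_mul_sphere,
      ev_normSq_pow_mul_sphere, Pi.zero_apply]
    push_cast
    ring)
  have h0 : ∫ x, f x * ev p x ∂ballMeasure n = 0 := by
    rw [h.green_harmonic hp, hc, mul_zero, neg_zero]
  have h2 : ∀ θ : Sphere n, g θ * ev (normSq n ^ (j + 1) * p -
      (j + 1 : ℝ) • (normSq n ^ (0 + 1) * p)) θ = -j * (g θ * ev p θ) := fun θ => by
    rw [ev_sub, ev_smul]
    simp only [ev_normSq_pow_mul_sphere]
    ring
  rw [map_sub, map_smul, polyLaplacian_normSq_pow_mul hp, polyLaplacian_normSq_pow_mul hp] at h1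
  simp only [h2, integral_const_mul, hc, mul_zero] at h1
  simp only [ev_sub, ev_smul, mul_sub, pow_zero, one_mul] at h1
  rw [integral_sub] at h1
  · simp only [mul_left_comm (f _), integral_const_mul, h0, mul_zero, sub_zero] at h1
    refine (mul_eq_zero.1 h1).resolve_left ?_
    have : (0 : ℝ) < n := by exact_mod_cast hn
    positivity
  · simpa only [ev_smul] using integrable_ball_mul_ev h.integrable_lap
      ((2 * (j + 1) * (2 * j + 2 * (0 : ℕ) + n) : ℝ) • (normSq n ^ j * p))
  · simpa only [ev_smul, pow_zero, one_mul] using integrable_ball_mul_ev h.integrable_lap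
      ((j + 1 : ℝ) • (2 * ((0 : ℕ) + 1) * (2 * (0 : ℕ) + 2 * (0 : ℕ) + n) : ℝ) • p)

/-- A solution with a nonvanishing component of order `ℓ` has eigenvalue `ℓ² (2ℓ + n)`. -/
lemma IsMomentSolution.eigenvalue_eq (h : IsMomentSolution μ u f g)
    (hp : p ∈ harmonic n ℓ) (hc : ∫ θ, g θ * ev p θ ∂sphereMeasure n ≠ 0) :
    μ = (ℓ : ℝ) ^ 2 * (2 * ℓ + n) := by
  rcases eq_or_ne ℓ 0 with rfl | hℓ
  · simpa [hc] using h.weak_of_zero hp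
  · have h1 := h.weak_of_pos hp hℓ 0
    rw [pow_zero, one_mul, h.green_harmonic hp] at h1
    have hℓ' : (ℓ : ℝ) ≠ 0 := by exact_mod_cast hℓ
    field_simp at h1
    push_cast at h1
    linear_combination h1

/-- A solution without boundary component of order `ℓ` has no component of order `ℓ`. -/
lemma IsMomentSolution.moment_eq_zero (hn : 1 ≤ n) (h : IsMomentSolution μ u f g)
    (hp : p ∈ harmonic n ℓ) (hc : ∫ θ, g θ * ev p θ ∂sphereMeasure n = 0) (j : ℕ) :
    ∫ x, u x * ev (normSq n ^ j * p) x ∂ballMeasure n = 0 := by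
  have hne : ∀ j : ℕ, (2 * (j + 1) * (2 * j + 2 * ℓ + n) : ℝ) ≠ 0 := fun j => by
    have : (0 : ℝ) < n := by exact_mod_cast hn
    positivity
  have hf : ∀ j : ℕ, ∫ x, f x * ev (normSq n ^ j * p) x ∂ballMeasure n = 0 := by
    intro j
    rcases eq_or_ne ℓ 0 with rfl | hℓ
    · exact h.lap_moment_zero hn hp hc j
    · have h1 := h.weak_of_pos hp hℓ j
      rw [hc, mul_zero, neg_zero] at h1
      exact (mul_eq_zero.1 h1).resolve_left (hne j)
  -- One power of `|x|²` higher, Green's identity turns vanishing moments of `f` and `g` into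
  -- vanishing moments of `u`.
  have h2 := h.green_normSq_pow hp j
  rw [hf, hc, mul_zero, sub_zero] at h2
  exact (mul_eq_zero.1 h2.symm).resolve_left (hne j)

lemma IsMomentSolution.ae_eq_zero (hn : 1 ≤ n) (h : IsMomentSolution μ u f g)
    (hc : ∀ ℓ, ∀ p ∈ harmonic n ℓ, ∫ θ, g θ * ev p θ ∂sphereMeasure n = 0) :
    u =ᵐ[ballMeasure n] 0 :=
  ae_eq_zero_of_moments h.integrable_val <| integral_mul_ev_eq_zero hn h.integrable_val
    measurable_id ae_mem_closedBall fun j ℓ p hp => h.moment_eq_zero hn hp (hc ℓ p hp) j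

end Moments

/-! ### The modes as polynomial classical solutions -/

section Modes

variable {ℓ : ℕ} {p : MvPolynomial (Fin n) ℝ}

/-- The polynomial which extends the mode of order `ℓ` with angular part `p`. -/
def modePoly (ℓ : ℕ) (p : MvPolynomial (Fin n) ℝ) : MvPolynomial (Fin n) ℝ :=
  (ℓ + 2 : ℝ) • p - (ℓ : ℝ) • (normSq n ^ (0 + 1) * p)

/-- The factor `|x|^ℓ` of the mode cancels the `|x|^(-ℓ)` of the radial extension. The origin is
excluded since `radialExt` is `0` there, whereas for `ℓ = 0` the polynomial is the constant `2 p`.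
-/
lemma ev_modePoly (hp : p ∈ harmonic n ℓ) {x : Space n} (hx : x ≠ 0) :
    ev (modePoly ℓ p) x = mode ℓ (fun θ : Sphere n => ev p θ) x := by
  have hx' : ‖x‖ ≠ 0 := norm_ne_zero_iff.2 hx
  rw [mode, radialExt_ev (isHomogeneous_of_mem_harmonic hp) hx, modePoly, ev_sub, ev_smul, ev_smul]
  simp only [ev_normSq_pow_mul, inv_pow, pow_add, zero_add, mul_one]
  field_simp

lemma ev_modePoly_sphere (θ : Sphere n) : ev (modePoly ℓ p) θ = 2 * ev p θ := by
  rw [modePoly, ev_sub, ev_smul, ev_smul]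
  simp only [ev_normSq_pow_mul_sphere]
  ring

/-- The Laplacian of the mode is `-2ℓ(2ℓ+n) p`, again harmonic. On the sphere the normal derivative
is `((ℓ+2)ℓ - ℓ(ℓ+2)) p = 0`, and `-∂_ν Δ` gives `2ℓ²(2ℓ+n) p`, while the mode itself equals `2p`.
-/
lemma isClassicalSolution_modePoly (hp : p ∈ harmonic n ℓ) :
    IsClassicalSolution ((ℓ : ℝ) ^ 2 * (2 * ℓ + n)) (ev (modePoly ℓ p)) := by
  have hph := isHomogeneous_of_mem_harmonic hp
  have hΔ : polyLaplacian (modePoly ℓ p) = (-(ℓ * (2 * (2 * ℓ + n))) : ℝ) • p := by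
    rw [modePoly, map_sub, map_smul, map_smul, polyLaplacian_normSq_pow_mul hp,
      polyLaplacian_of_mem_harmonic hp, smul_zero, zero_sub, pow_zero, one_mul, smul_smul, neg_smul]
    congr 2
    push_cast
    ring
  refine ⟨contDiff_ev _, fun x _ => ?_, fun θ => ?_, fun θ => ?_⟩
  · rw [laplacian_ev, hΔ, laplacian_ev, map_smul, polyLaplacian_of_mem_harmonic hp, smul_zero]
    simp
  · have h1 : ((ℓ + 2 : ℝ) • p).IsHomogeneous ℓ :=
      (MvPolynomial.homogeneousSubmodule (Fin n) ℝ ℓ).smul_mem _ hph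
    rw [modePoly, normalDeriv_ev_sub_smul h1 (isHomogeneous_normSq_pow_mul hph (0 + 1)), ev_smul,
      ev_normSq_pow_mul_sphere]
    push_cast
    ring
  · have h1 : ((-(ℓ * (2 * (2 * ℓ + n))) : ℝ) • p).IsHomogeneous ℓ :=
      (MvPolynomial.homogeneousSubmodule (Fin n) ℝ ℓ).smul_mem _ hph
    rw [laplacian_ev, hΔ, normalDeriv_ev h1, ev_modePoly_sphere, ev_smul]
    ring

lemma mode_ae_eq (hn : 1 ≤ n) (hp : p ∈ harmonic n ℓ) :
    mode ℓ (fun θ : Sphere n => ev p θ) =ᵐ[ballMeasure n] ev (modePoly ℓ p) := by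
  have : Nonempty (Fin n) := ⟨⟨0, hn⟩⟩
  have h : ∀ᵐ x : Space n, x ≠ 0 := Measure.ae_ne volume 0
  exact (ae_restrict_of_ae h).mono fun x hx => (ev_modePoly hp hx).symm

lemma ev_modePoly_not_ae_zero {θ : Sphere n} (hp : p ∈ harmonic n ℓ) (hθ : ev p θ ≠ 0) :
    ¬ ev (modePoly ℓ p) =ᵐ[ballMeasure n] 0 := by
  intro h
  have h1 := Measure.eqOn_open_of_ae_eq h isOpen_ball (continuous_ev _).continuousOn
    continuousOn_const
  -- At `θ/2` the radial factor is `2^(-ℓ) (ℓ + 2 - ℓ/4)`, which is positive.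
  have hx : (1 / 2 : ℝ) • (θ : Space n) ∈ ball (0 : Space n) 1 := by
    simp [norm_smul]; norm_num
  have h2 := h1 hx
  rw [modePoly, ev_sub, ev_smul, ev_smul] at h2
  simp only [ev_normSq_pow_mul, ev_smul_arg (isHomogeneous_of_mem_harmonic hp), norm_smul,
    norm_eq_of_mem_sphere, Pi.zero_apply] at h2
  norm_num at h2
  have h3 : ((1 / 2 : ℝ) ^ ℓ * ev p θ) * (3 / 4 * ℓ + 2) = 0 := by
    linear_combination h2
  have h4 : (0 : ℝ) < 3 / 4 * ℓ + 2 := by positivity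
  exact mul_ne_zero (mul_ne_zero (by positivity) hθ) h4.ne' h3

end Modes

/-! ### Classification of eigenvalues and eigenfunctions -/

lemma strictMono_eigenvalue (hn : 1 ≤ n) : StrictMono fun ℓ : ℕ => (ℓ : ℝ) ^ 2 * (2 * ℓ + n) := by
  intro a b hab
  have hn' : (0 : ℝ) < n := by exact_mod_cast hn
  have hab' : (a : ℝ) < b := by exact_mod_cast hab
  have ha : (0 : ℝ) ≤ a := by positivity
  show (a : ℝ) ^ 2 * (2 * a + n) < (b : ℝ) ^ 2 * (2 * b + n)
  gcongr

/-- For any other `μ` every harmonic component of the trace would vanish, and with them `u`. -/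
lemma IsEigenfunction.exists_eigenvalue_eq (hn : 1 ≤ n) {μ : ℝ} {u : Space n → ℝ}
    (h : IsEigenfunction n μ u) : ∃ ℓ : ℕ, μ = (ℓ : ℝ) ^ 2 * (2 * ℓ + n) := by
  obtain ⟨hu, U, rfl, g, hT, hW⟩ := h
  have hM := isMomentSolution_of_weak hn hT hW
  by_contra! hμ
  refine hu (hM.ae_eq_zero hn fun ℓ p hp => ?_)
  by_contra hc
  exact hμ ℓ (hM.eigenvalue_eq hp hc)

lemma isEigenfunction_of_ae_eq_mode (hn : 2 ≤ n) {ℓ : ℕ} {Y : Sphere n → ℝ}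
    (hY : IsSphericalHarmonic ℓ Y) (hY0 : Y ≠ 0) {u : Space n → ℝ}
    (hu : u =ᵐ[ballMeasure n] mode ℓ Y) :
    IsEigenfunction n ((ℓ : ℝ) ^ 2 * (2 * ℓ + n)) u := by
  have hn1 : 1 ≤ n := by omega
  obtain ⟨p, hp, rfl⟩ := hY.exists_ev hn
  obtain ⟨θ, hθ⟩ := Function.ne_iff.1 hY0
  have hu' := hu.trans (mode_ae_eq hn1 hp)
  exact ⟨fun h => ev_modePoly_not_ae_zero hp hθ (hu'.symm.trans h),
    H2.ofSmooth u _ (contDiff_ev (modePoly ℓ p)) hu', rfl,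
    isWeakSolution_ofSmooth hn1 (isClassicalSolution_modePoly hp)⟩

lemma IsEigenfunction.exists_ae_eq_mode (hn : 1 ≤ n) {ℓ : ℕ} {u : Space n → ℝ}
    (h : IsEigenfunction n ((ℓ : ℝ) ^ 2 * (2 * ℓ + n)) u) :
    ∃ Y : Sphere n → ℝ, IsSphericalHarmonic ℓ Y ∧ Y ≠ 0 ∧ u =ᵐ[ballMeasure n] mode ℓ Y := by
  obtain ⟨hu, U, rfl, g, hT, hW⟩ := h
  have hM := isMomentSolution_of_weak hn hT hW
  -- The factor `1/2` compensates for the boundary value `2q` of the mode.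
  obtain ⟨q, hq, hqp⟩ := exists_harmonic_projection hn ℓ
    (hM.integrable_trace.const_mul (1 / 2 : ℝ))
  have hcl := isClassicalSolution_modePoly hq
  have hT' := hasTraces_ofSmooth (hw := contDiff_ev (modePoly ℓ q)) (hu := EventuallyEq.refl _ _)
  rw [show normalDeriv (ev (modePoly ℓ q)) = 0 from funext hcl.2.2.1] at hT'
  have hM' := isMomentSolution_of_weak hn hT' (μ := (ℓ : ℝ) ^ 2 * (2 * ℓ + n))
    (by rw [laplacian_ofSmooth]; exact weak_of_classical hn hcl)
  have hD := hM.sub hM'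
  -- A nonzero component of the difference in order `m` forces `m = ℓ`, because the eigenvalues are
  -- distinct; in order `ℓ` the choice of `q` has removed it.
  have h0 := hD.ae_eq_zero hn fun m p hp => by
    by_contra hc
    obtain rfl : ℓ = m := (strictMono_eigenvalue hn).injective (hD.eigenvalue_eq hp hc)
    refine hc ?_
    have h1 := hqp p hp
    simp only [mul_assoc, integral_const_mul] at h1
    simp only [ev_modePoly_sphere, sub_mul]
    rw [integral_sub (integrable_sphere_mul hM.integrable_trace (continuous_ev_sphere p))
      (integrable_sphere (((continuous_ev_sphere q).const_mul 2).fun_mul (continuous_ev_sphere p)))]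
    simp only [mul_assoc, integral_const_mul]
    linarith
  have h1 : U.val =ᵐ[ballMeasure n] ev (modePoly ℓ q) :=
    h0.mono fun x hx => sub_eq_zero.1 hx
  refine ⟨fun θ => ev q θ, isSphericalHarmonic_ev hq, fun hz => hu ?_,
    h1.trans (mode_ae_eq hn hq).symm⟩
  have hq0 := eq_zero_of_ev_sphere_eq_zero hn (isHomogeneous_of_mem_harmonic hq) (congrFun hz)
  simpa [hq0, modePoly] using h1

end BiharmonicSteklov
end

theorem mainTheorem8 (n : ℕ) (hn : 2 ≤ n) :
    (∀ μ : ℝ, BiharmonicSteklov.IsEigenvalue n μ ↔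
      ∃ ℓ : ℕ, μ = (ℓ : ℝ) ^ 2 * (2 * (ℓ : ℝ) + (n : ℝ))) ∧
    (∀ (ℓ : ℕ) (u : BiharmonicSteklov.Space n → ℝ),
      BiharmonicSteklov.IsEigenfunction n ((ℓ : ℝ) ^ 2 * (2 * (ℓ : ℝ) + (n : ℝ))) u ↔
        ∃ Y : BiharmonicSteklov.Sphere n → ℝ,
          BiharmonicSteklov.IsSphericalHarmonic ℓ Y ∧ Y ≠ 0 ∧
            u =ᵐ[BiharmonicSteklov.ballMeasure n] BiharmonicSteklov.mode ℓ Y) ∧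
    (∀ (ℓ : ℕ) (Y : BiharmonicSteklov.Sphere n → ℝ),
      BiharmonicSteklov.IsSphericalHarmonic ℓ Y →
        ∃ w : BiharmonicSteklov.Space n → ℝ,
          (∀ x, x ≠ 0 → w x = BiharmonicSteklov.mode ℓ Y x) ∧
          BiharmonicSteklov.IsClassicalSolution
            ((ℓ : ℝ) ^ 2 * (2 * (ℓ : ℝ) + (n : ℝ))) w) := by
  have hn1 : 1 ≤ n := by omega
  refine ⟨fun μ => ⟨fun ⟨u, hu⟩ => hu.exists_eigenvalue_eq hn1, ?_⟩, fun ℓ u =>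
    ⟨fun h => h.exists_ae_eq_mode hn1, fun ⟨Y, hY, hY0, hu⟩ =>
      BiharmonicSteklov.isEigenfunction_of_ae_eq_mode hn hY hY0 hu⟩, fun ℓ Y hY => ?_⟩
  · rintro ⟨ℓ, rfl⟩
    obtain ⟨p, hp, hp0⟩ := BiharmonicSteklov.exists_mem_harmonic_ne_zero hn ℓ
    refine ⟨_, BiharmonicSteklov.isEigenfunction_of_ae_eq_mode hn
      (BiharmonicSteklov.isSphericalHarmonic_ev hp) (fun h => hp0 ?_) (Filter.EventuallyEq.refl _ _)⟩
    exact BiharmonicSteklov.eq_zero_of_ev_sphere_eq_zero hn1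
      (BiharmonicSteklov.isHomogeneous_of_mem_harmonic hp) (congrFun h)
  · obtain ⟨p, hp, rfl⟩ := hY.exists_ev hn
    exact ⟨_, fun x hx => BiharmonicSteklov.ev_modePoly hp hx,
      BiharmonicSteklov.isClassicalSolution_modePoly hp⟩
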